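/- A 2-stack call-return alphabet $\widetilde\Sigma$ consists of five pairwise disjoint finite sets: for $s\in\{1,2\}$, a set $\Sigma_c^s$ of calls and a set $\Sigma_r^s$ of returns of stack $s$, and a set $\Sigma_{int}$ of internal actions. Let $\Sigma_c=\Sigma_c^1\cup\Sigma_c^2$, $\Sigma_r=\Sigma_r^1\cup\Sigma_r^2$, $\Sigma=\Sigma_c\cup\Sigma_r\cup\Sigma_{int}$. A string over $\Sigma$ is $s$-well formed if it is generated by the grammar $X ::= aXb \mid XX \mid \varepsilon \mid c$ with $a\in\Sigma_c^s$, $b\in\Sigma_r^s$, $c\in\Sigma\setminus(\Sigma_c^s\cup\Sigma_r^s)$. An infinite nested word is a structure $W=(\mathbb N_+,\lessdot,\mu,\lambda)$ with $\lambda:\mathbb N_+\to\Sigma$, $i\lessdot j$ iff $j=i+1$, and $(i,j)\in\mu$ iff $i<j$ and, for some $s$, $\lambda(i)\in\Sigma_c^s$, $\lambda(j)\in\Sigma_r^s$ and $\lambda(i+1)\cdots\lambda(j-1)$ is $s$-well formed; a finite nested word is defined likewise on $\{1,\dots,n\}$, $n\ge 1$. The $r$-sphere $\mathrm{Sph}_r(W,i)$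 is the substructure of $W$ induced by the nodes at distance at most $r$ from $i$ in the Gaifman graph (the undirected graph with an edge between nodes related by $\lessdot$ or $\mu$), with $i$ as a distinguished constant. $\mathit{Spheres}_r(\widetilde\Sigma)$ is the set of (isomorphism types of) $r$-spheres around nodes of finite nested words over $\widetilde\Sigma$. A generalized Büchi 2-stack nested-word automaton is a tuple $\mathcal B=(Q,\delta,Q_I,F,C)$ with a finite set $Q$ of states, sets $Q_I,F,C\subseteq Q$ of initial, final and calling states, and $\delta=\langle\delta_1,\delta_2\rangle$ with $\delta_1\subseteq Q\times\Sigma\times Q$ and $\delta_2\subseteq Q\times Q\times\Sigma_r\times Q$. A run of $\mathcal B$ on $W$ is a map $\rho:\mathbb N_+\to Q$ such that $(q,\lambda(1),\rho(1))\in\delta_1$ for some $q\in Q_I$ and, for all $i\ge2$, $(\rho(\mu^{-1}(i)),\rho(i-1),\lambda(i),\rho(i))\in\delta_2$ if $\lambda(i)\in\Sigma_r$ and $\mu^{-1}(i)$ is defined, and $(\rho(i-1),\lambda(i),\rho(i))\in\delta_1$ otherwise. It is accepting if $\rho(i)\in F$ for infinitely many $i$ and, whenever $\rho(i)\in C$,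 $\lambda(i)\in\Sigma_c$ and $\mu(i)$ is defined. **Proposition.** Let $\widetilde\Sigma$ be a 2-stack call-return alphabet and let $r\in\mathbb N$. There are a generalized Büchi 2-stack nested-word automaton $\mathcal B=(Q,\delta,Q_I,F,C)$ over $\widetilde\Sigma$ and a mapping $\eta:Q\to\mathit{Spheres}_r(\widetilde\Sigma)$ such that 1. every infinite nested word over $\widetilde\Sigma$ admits an accepting run of $\mathcal B$, and 2. for every infinite nested word $W$ over $\widetilde\Sigma$, every accepting run $\rho$ of $\mathcal B$ on $W$, and every node $i$ of $W$, $\eta(\rho(i))\cong\mathrm{Sph}_r(W,i)$. -/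

import Mathlib

universe u v

/-- The role of a letter of a `K`-stack call-return alphabet. -/
inductive LetterKind (K : ℕ) : Type where
  | call (s : Fin K) : LetterKind K
  | ret (s : Fin K) : LetterKind K
  | internal : LetterKind K

/-- A `K`-stack call-return alphabet. The finite set of all letters is partitioned, by the function
`kind`, into the pairwise disjoint (possibly empty) alphabets of calls of stack `s`, of returns of
stack `s`, and of internal actions. -/
structure CallReturnAlphabet (K : ℕ) : Type (u + 1) where
  Letter : Type u
  finite_letter : Finite Letter
  kind : Letter → LetterKind K

namespace CallReturnAlphabet

variable {K : ℕ} (A : CallReturnAlphabet.{u} K)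

/-- The calls of stack `s`. -/
def callsOf (s : Fin K) : Set A.Letter := {a | A.kind a = LetterKind.call s}

/-- The returns of stack `s`. -/
def retsOf (s : Fin K) : Set A.Letter := {a | A.kind a = LetterKind.ret s}

/-- All calls. -/
def calls : Set A.Letter := ⋃ s, A.callsOf s

/-- All returns. -/
def rets : Set A.Letter := ⋃ s, A.retsOf s

/-- The strings generated by the grammar `X ::= a X b | X X | ε | c`, where `a` is a call of
stack `s`, `b` is a return of stack `s`, and `c` is any other letter. -/
inductive WellFormed (s : Fin K) : List A.Letter → Prop where
  | wrap {a b : A.Letter} {w : List A.Letter} (ha : a ∈ A.callsOf s) (hb : b ∈ A.retsOf s)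
      (hw : WellFormed s w) : WellFormed s (a :: (w ++ [b]))
  | append {w w' : List A.Letter} (hw : WellFormed s w) (hw' : WellFormed s w') :
      WellFormed s (w ++ w')
  | nil : WellFormed s []
  | other {c : A.Letter} (hc : c ∉ A.callsOf s) (hr : c ∉ A.retsOf s) : WellFormed s [c]

end CallReturnAlphabet

/-- A structure with universe `N`, two binary relations `succ` and `mu`, and a labeling. -/
structure LabeledStructure (L : Type u) (N : Type v) where
  succ : N → N → Prop
  mu : N → N → Prop
  label : N → L

namespace LabeledStructure

variable {L : Type u} {N : Type v}

/-- The Gaifman graph: two distinct elements are adjacent iff they are related by `succ` or `mu`,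
in one of the two directions. -/
def gaifman (S : LabeledStructure L N) : SimpleGraph N :=
  SimpleGraph.fromRel fun i j => S.succ i j ∨ S.mu i j

/-- The universe of the `r`-sphere around `i`: all elements at distance at most `r` from `i` in the
Gaifman graph (elements in other connected components are at distance `⊤`). -/
def ball (S : LabeledStructure L N) (r : ℕ) (i : N) : Set N :=
  {j | S.gaifman.edist i j ≤ (r : ℕ∞)}

end LabeledStructure

/-- A labeled structure with a distinguished element. -/
structure PointedStructure (L : Type u) where
  carrier : Type
  toStructure : LabeledStructure L carrier
  center : carrier

/-- Two pointed structures are isomorphic. -/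
def PointedStructure.Isomorphic {L : Type u} (S T : PointedStructure L) : Prop :=
  ∃ e : S.carrier ≃ T.carrier,
    (∀ i j, S.toStructure.succ i j ↔ T.toStructure.succ (e i) (e j)) ∧
    (∀ i j, S.toStructure.mu i j ↔ T.toStructure.mu (e i) (e j)) ∧
    (∀ i, S.toStructure.label i = T.toStructure.label (e i)) ∧
    e S.center = T.center

/-- The `r`-sphere of `S` around `i`: the substructure induced by the elements at distance at most
`r` from `i`, with `i` as distinguished element. -/
def LabeledStructure.sphere {L : Type u} {N : Type} (S : LabeledStructure L N) (r : ℕ) (i : N) :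
    PointedStructure L where
  carrier := S.ball r i
  toStructure :=
    { succ := fun x y => S.succ x.1 y.1
      mu := fun x y => S.mu x.1 y.1
      label := fun x => S.label x.1 }
  center := ⟨i, by simp [LabeledStructure.ball]⟩

section NestedWords

variable {K : ℕ} (A : CallReturnAlphabet.{u} K)

/-- A (finite) nested word, with positions `0, …, n - 1`, where `n ≥ 1`. -/
structure NestedWord (n : ℕ) extends LabeledStructure A.Letter (Fin n) where
  pos : 0 < n
  succ_iff : ∀ i j : Fin n, succ i j ↔ (j : ℕ) = i + 1
  mu_iff : ∀ i j : Fin n, mu i j ↔ ∃ s : Fin K, i < j ∧ label i ∈ A.callsOf s ∧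
    label j ∈ A.retsOf s ∧
    A.WellFormed s (List.ofFn fun k : Fin ((j : ℕ) - (i + 1)) =>
      label ⟨(i : ℕ) + 1 + k, by have := k.isLt; have := j.isLt; omega⟩)

/-- An infinite nested word, with positions `0, 1, 2, …`. -/
structure InfNestedWord extends LabeledStructure A.Letter ℕ where
  succ_iff : ∀ i j : ℕ, succ i j ↔ j = i + 1
  mu_iff : ∀ i j : ℕ, mu i j ↔ ∃ s : Fin K, i < j ∧ label i ∈ A.callsOf s ∧
    label j ∈ A.retsOf s ∧
    A.WellFormed s (List.ofFn fun k : Fin (j - (i + 1)) => label (i + 1 + k))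

/-- The `r`-spheres (up to isomorphism) that arise from finite nested words. -/
def Spheres (r : ℕ) : Set (PointedStructure A.Letter) :=
  {S | ∃ (n : ℕ) (W : NestedWord A n) (i : Fin n), S.Isomorphic (W.sphere r i)}

/-- A generalized (Büchi) multi-stack nested-word automaton, with finite set of states `Q`,
transition relations `δ₁ ⊆ Q × Σ × Q` and `δ₂ ⊆ Q × Q × Σ_ret × Q`, where `Σ` is the set of letters
and `Σ_ret` the set of returns, initial states, final states, and calling states. -/
structure GenNWA where
  Q : Type
  finite_Q : Finite Q
  δ₁ : Set (Q × A.Letter × Q)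
  δ₂ : Set (Q × Q × A.Letter × Q)
  δ₂_ret : ∀ p q a q', (p, q, a, q') ∈ δ₂ → a ∈ A.rets
  init : Set Q
  final : Set Q
  calling : Set Q

end NestedWords

namespace GenNWA

variable {K : ℕ} {A : CallReturnAlphabet.{u} K}

/-- `ρ` is a run of the automaton on the infinite nested word `W`. (A position has at most one
`mu`-predecessor.) -/
def IsRun (B : GenNWA A) (W : InfNestedWord A) (ρ : ℕ → B.Q) : Prop :=
  (∃ q ∈ B.init, (q, W.label 0, ρ 0) ∈ B.δ₁) ∧
  ∀ i : ℕ,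
    (∀ c, W.label (i + 1) ∈ A.rets → W.mu c (i + 1) →
      (ρ c, ρ i, W.label (i + 1), ρ (i + 1)) ∈ B.δ₂) ∧
    (¬ (W.label (i + 1) ∈ A.rets ∧ ∃ c, W.mu c (i + 1)) →
      (ρ i, W.label (i + 1), ρ (i + 1)) ∈ B.δ₁)

/-- `ρ` is an accepting run: some final state is visited infinitely often, and calling states occur
only at calls that have a matching return. -/
def IsAcceptingRun (B : GenNWA A) (W : InfNestedWord A) (ρ : ℕ → B.Q) : Prop :=
  B.IsRun W ρ ∧ {i : ℕ | ρ i ∈ B.final}.Infinite ∧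
  ∀ i : ℕ, ρ i ∈ B.calling → W.label i ∈ A.calls ∧ ∃ j, W.mu i j

/-- The language of infinite nested words of the automaton. -/
def omegaLanguage (B : GenNWA A) : Set (InfNestedWord A) :=
  {W | ∃ ρ : ℕ → B.Q, B.IsAcceptingRun W ρ}

end GenNWA

/-!
Draw an infinite nested word with two stacks in the plane, with its positions on a horizontal line,
the edges of `mu` for the first stack as arcs above the line, and those for the second stack as arcs
below it. Arcs on the same side do not cross, so this is a plane graph of degree at most three,
and a sphere is determined by knowing, for each short word of directions, whether it can be followed from
the center, which letter it reaches, and which of these words reach the same position.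

Label the positions by finitely many colours such that distinct positions connected by a path of
length at most `m = 2 r + 1` have distinct colours (`TwoPage.exists_separates`). Then two words of
length at most `r`, one of them possibly prolonged by a step, reach the same position if and only if
they reach the same colour. The states of the automaton are views: the letters and colours seen
along all words of length at most `m + 1` from some position of some nested word with such a
colouring. The automaton guesses views and checks that they are compatible along the edges, which
suffices for every state to be the true view of its position with respect to the guessed colours
(`obs_of_isAcceptingRun`).

It remains to see that the guessed colouring separates positions as it should
(`TwoPage.separates_of_obs`). Otherwise a shortest word `w` that leads from some position to a
different one of the same colour passes through distinct colours before its end. Since views occur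
in properly coloured nested words, `w` describes a simple cycle in such a word, whereas in the given
word it can be followed over and over again, each time with the same colours. A discrete version of
Hopf's theorem on turning numbers excludes this (`TwoPage.closes_of_closed`). The turn between
consecutive edges depends only on their directions, so by the existence of the simple cycle each
round of `w` makes exactly one full turn (`TwoPage.sum_turn_of_closed`). Hence the path cannot close
up after several rounds. If it never closes up, it is an infinite spiral; but a simple path that
starts at a position with finitely many positions to its left, and that reaches positions further
and further to the right, has at those times made only boundedly many turns
(`TwoPage.sum_turn_eq_zero_of_injective`).
-/

/-! ### Two-page graphs and turning numbers -/

/-- A graph on `ℕ` drawn in the plane: the spine edges `i — i + 1` (index `none`) lie on a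
horizontal line, the arcs with index `some 0` are drawn above and those with index `some 1` below
that line, and arcs on the same side do not cross. Every edge is directed to the right. -/
structure TwoPage where
  edge : Option (Fin 2) → ℕ → ℕ → Prop
  spine : ∀ i j, edge none i j ↔ j = i + 1
  arc_lt : ∀ s i j, edge (some s) i j → i < j
  nest : ∀ s a b c d, edge (some s) a b → edge (some s) c d → a < c → c < b → d < b
  arc_right : ∀ s a b c, edge (some s) a b → edge (some s) a c → b = c

/-- A direction of travel: a kind of edge, and whether it is traversed to the right. -/
abbrev Dir := Option (Fin 2) × Bool

/-- The opposite direction. -/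
def Dir.inv (d : Dir) : Dir := (d.1, !d.2)

/-- The number of half turns, counted counterclockwise, that an edge traversed in direction `d`
makes around a point strictly between its endpoints on the horizontal line. -/
def Dir.bend : Dir → ℤ
  | (none, _) => 0
  | (some s, f) => if decide (s = 0) = f then -1 else 1

/-- The half turns made between two consecutive edges with directions `d` and `e` that do not
return to their starting point, as measured by the direction of the secants. -/
def Dir.turn (d e : Dir) : ℤ :=
  if d.2 = e.2 then 0 else if d.bend ≠ 0 then d.bend else e.bend

/-- The half turns that the edge from `a` to `b`, traversed in direction `d`, makes around `v`. -/
def wind (v a b : ℕ) (d : Dir) : ℤ :=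
  if (a < v ∧ v < b) ∨ (b < v ∧ v < a) then d.bend else 0

namespace TwoPage

variable (G : TwoPage)

/-- Following one edge in direction `d` leads from `i` to `j`. -/
def Step (d : Dir) (i j : ℕ) : Prop :=
  if d.2 then G.edge d.1 i j else G.edge d.1 j i

variable {G}

theorem edge_lt {o : Option (Fin 2)} {i j : ℕ} (h : G.edge o i j) : i < j := by
  cases o with
  | none => have := (G.spine i j).1 h; omega
  | some s => exact G.arc_lt s i j h

theorem edge_right_unique {o : Option (Fin 2)} {i j k : ℕ} (h : G.edge o i j)
    (h' : G.edge o i k) : j = k := by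
  cases o with
  | none => have := (G.spine i j).1 h; have := (G.spine i k).1 h'; omega
  | some s => exact G.arc_right s i j k h h'

theorem edge_left_unique {o : Option (Fin 2)} {i j k : ℕ} (h : G.edge o i k)
    (h' : G.edge o j k) : i = j := by
  cases o with
  | none => have := (G.spine i k).1 h; have := (G.spine j k).1 h'; omega
  | some s =>
    have h1 := edge_lt h
    have h2 := edge_lt h'
    have h3 := G.nest s i k j k h h'
    have h4 := G.nest s j k i k h' h
    omega

theorem Step.inv {d : Dir} {i j : ℕ} (h : G.Step d i j) : G.Step d.inv j i := by
  rcases d with ⟨o, _ | _⟩ <;> simpa [Step, Dir.inv] using h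

theorem Step.unique {d : Dir} {i j k : ℕ} (h : G.Step d i j) (h' : G.Step d i k) : j = k := by
  rcases d with ⟨o, _ | _⟩
  · exact edge_left_unique (by simpa [Step] using h) (by simpa [Step] using h')
  · exact edge_right_unique (by simpa [Step] using h) (by simpa [Step] using h')

theorem Step.injective {d : Dir} {i j k : ℕ} (h : G.Step d i k) (h' : G.Step d j k) : i = j :=
  h.inv.unique h'.inv

theorem Step.ne {d : Dir} {i j : ℕ} (h : G.Step d i j) : i ≠ j := by
  rcases d with ⟨o, _ | _⟩
  · exact (edge_lt (by simpa [Step] using h)).ne'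
  · exact (edge_lt (by simpa [Step] using h)).ne

theorem wind_swap (v a b : ℕ) (d : Dir) : wind v b a d.inv = -wind v a b d := by
  have : d.inv.bend = -d.bend := by
    rcases d with ⟨_ | s, _ | _⟩
    · rfl
    · rfl
    · by_cases h : s = 0 <;> simp [Dir.inv, Dir.bend, h]
    · by_cases h : s = 0 <;> simp [Dir.inv, Dir.bend, h]
  simp only [wind, this]
  split_ifs <;> omega

/-- The two ways of moving the ends of a secant along two disjoint edges turn it equally far. -/
theorem wind_square {d e : Dir} {a a' b b' : ℕ} (h : G.Step d a a') (h' : G.Step e b b')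
    (h1 : a ≠ b) (h2 : a ≠ b') (h3 : a' ≠ b) (h4 : a' ≠ b') :
    wind b' a a' d - wind b a a' d = wind a' b b' e - wind a b b' e := by
  have key : ∀ (o o' : Option (Fin 2)) (a a' b b' : ℕ), G.edge o a a' → G.edge o' b b' →
      a ≠ b → a ≠ b' → a' ≠ b → a' ≠ b' →
      wind b' a a' (o, true) - wind b a a' (o, true)
        = wind a' b b' (o', true) - wind a b b' (o', true) := by
    intro o o' a a' b b' h h' h1 h2 h3 h4
    have l1 := edge_lt h
    have l2 := edge_lt h'
    rcases o with _ | s <;> rcases o' with _ | s'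
    · simp [wind, Dir.bend]
    · have := (G.spine _ _).1 h
      simp only [wind, Dir.bend]
      split_ifs <;> omega
    · have := (G.spine _ _).1 h'
      simp only [wind, Dir.bend]
      split_ifs <;> omega
    · by_cases hs : s = s'
      · subst hs
        have n1 := G.nest s _ _ _ _ h h'
        have n2 := G.nest s _ _ _ _ h' h
        simp only [wind]
        split_ifs <;> omega
      · have hb : Dir.bend (some s', true) = -Dir.bend (some s, true) := by
          clear * - hs
          revert s s'; decide
        simp only [wind, hb]
        split_ifs <;> omega
  rcases d with ⟨o, _ | _⟩ <;> rcases e with ⟨o', _ | _⟩ <;> simp only [Step] at h h'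
  · have := key o o' a' a b' b h h' h4 h3 h2 h1
    have e1 := wind_swap b a' a (o, true)
    have e2 := wind_swap b' a' a (o, true)
    have e3 := wind_swap a b' b (o', true)
    have e4 := wind_swap a' b' b (o', true)
    simp only [Dir.inv, Bool.not_true] at e1 e2 e3 e4
    omega
  · have := key o o' a' a b b' h h' h3 h4 h1 h2
    have e1 := wind_swap b a' a (o, true)
    have e2 := wind_swap b' a' a (o, true)
    simp only [Dir.inv, Bool.not_true] at e1 e2
    omega
  · have := key o o' a a' b' b h h' h2 h1 h4 h3
    have e3 := wind_swap a b' b (o', true)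
    have e4 := wind_swap a' b' b (o', true)
    simp only [Dir.inv, Bool.not_true] at e3 e4
    omega
  · exact key o o' a a' b b' h h' h1 h2 h3 h4

/-- The turn between consecutive edges depends only on their directions. -/
theorem wind_add_wind {d e : Dir} {a b c : ℕ} (h : G.Step d a b) (h' : G.Step e b c)
    (hac : a ≠ c) : wind a b c e + wind c a b d = d.turn e := by
  rcases d with ⟨o, f⟩
  rcases e with ⟨o', f'⟩
  have l1 : if f then a < b else b < a := by
    cases f <;> simp only [Step] at h <;> exact edge_lt h
  have l2 : if f' then b < c else c < b := by
    cases f' <;> simp only [Step] at h' <;> exact edge_lt h'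
  by_cases hf : f = f'
  · subst hf
    simp only [wind, Dir.turn, if_true]
    cases f <;> simp only [if_true, Bool.false_eq_true, if_false] at l1 l2 <;>
      split_ifs <;> omega
  · have hne : o ≠ o' := by
      rintro rfl
      have : f' = !f := by cases f <;> cases f' <;> simp_all
      subst this
      exact hac (Step.unique (Step.inv h) h')
    rcases o with _ | s
    · have hs : b = a + 1 ∨ a = b + 1 := by
        cases f <;> simp only [Step] at h <;> have := (G.spine _ _).1 h <;> omega
      have h0 : Dir.bend (none, f) = 0 := rfl
      simp only [wind, Dir.turn, hf, h0]
      cases f <;> cases f' <;> simp at l1 l2 hf <;> simp <;> omega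
    · rcases o' with _ | s'
      · have hs : b = c + 1 ∨ c = b + 1 := by
          cases f' <;> simp only [Step] at h' <;> have := (G.spine _ _).1 h' <;> omega
        have h0 : Dir.bend (none, f') = 0 := rfl
        have h1 : Dir.bend (some s, f) ≠ 0 := by simp only [Dir.bend]; split_ifs <;> omega
        simp only [wind, Dir.turn, hf, h0]
        cases f <;> cases f' <;> simp at l1 l2 hf <;> simp [h1] <;> omega
      · have hb : Dir.bend (some s', f') = Dir.bend (some s, f) := by
          clear * - hf hne
          revert s s' f f'; decide
        have h1 : Dir.bend (some s, f) ≠ 0 := by simp only [Dir.bend]; split_ifs <;> omega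
        simp only [wind, Dir.turn, hf, hb]
        cases f <;> cases f' <;> simp at l1 l2 hf <;> simp [h1] <;> split_ifs <;> omega

/-! ### Turning numbers of simple paths -/

/-- A discrete form of Hopf's homotopy: the total turn of a simple path equals the winding of the
path around its first vertex plus the winding around its last vertex. -/
theorem sum_turn_of_simple {p : ℕ → ℕ} {u : ℕ → Dir} (n : ℕ)
    (hp : ∀ t ≤ n, G.Step (u t) (p t) (p (t + 1)))
    (hinj : ∀ s t, s < t → t ≤ n + 1 → p s ≠ p t) :
    ∑ t ∈ Finset.range n, (u t).turn (u (t + 1)) =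
      ∑ t ∈ Finset.range n, wind (p 0) (p (t + 1)) (p (t + 2)) (u (t + 1)) +
      ∑ t ∈ Finset.range n, wind (p (n + 1)) (p t) (p (t + 1)) (u t) := by
  induction n with
  | zero => simp
  | succ n ih =>
    rw [Finset.sum_range_succ, ih (fun t ht => hp t (by omega))
      (fun s t h1 h2 => hinj s t h1 (by omega)), Finset.sum_range_succ, Finset.sum_range_succ _ n,
      ← wind_add_wind (hp n (by omega)) (hp (n + 1) le_rfl) (hinj n (n + 2) (by omega) le_rfl)]
    have key : ∀ k ≤ n, ∑ t ∈ Finset.range k, wind (p (n + 2)) (p t) (p (t + 1)) (u t) =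
        ∑ t ∈ Finset.range k, wind (p (n + 1)) (p t) (p (t + 1)) (u t) +
        (wind (p k) (p (n + 1)) (p (n + 2)) (u (n + 1)) -
          wind (p 0) (p (n + 1)) (p (n + 2)) (u (n + 1))) := by
      intro k hk
      induction k with
      | zero => simp
      | succ k ihk =>
        rw [Finset.sum_range_succ, Finset.sum_range_succ, ihk (by omega)]
        have := wind_square (hp k (by omega)) (hp (n + 1) le_rfl)
          (hinj k (n + 1) (by omega) (by omega)) (hinj k (n + 2) (by omega) (by omega))
          (hinj (k + 1) (n + 1) (by omega) (by omega)) (hinj (k + 1) (n + 2) (by omega) le_rfl)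
        linarith
    rw [show n + 1 + 1 = n + 2 from rfl, key n le_rfl]
    ring

theorem sum_periodic_shift {f : ℕ → ℤ} {n : ℕ} (hf : ∀ t, f (t + n) = f t) (k : ℕ) :
    ∑ t ∈ Finset.range n, f (t + k) = ∑ t ∈ Finset.range n, f t := by
  induction k with
  | zero => rfl
  | succ k ih =>
    have h := Finset.sum_range_succ' (fun t => f (t + k)) n
    rw [Finset.sum_range_succ] at h
    rw [← ih]
    have h1 : f (n + k) = f (0 + k) := by rw [add_comm n k, hf, zero_add]
    simp only [h1, add_left_inj] at h
    rw [h]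
    exact Finset.sum_congr rfl fun t _ => by congr 1; ring

/-- The total turn of a simple closed path with at least three vertices is one full turn, in one of
the two senses. -/
theorem sum_turn_of_closed {p : ℕ → ℕ} {u : ℕ → Dir} {n : ℕ} (hn : 3 ≤ n)
    (hp : ∀ t, G.Step (u t) (p t) (p (t + 1))) (hpn : ∀ t, p (t + n) = p t)
    (hun : ∀ t, u (t + n) = u t) (hinj : ∀ s t, p s = p t → s ≡ t [MOD n]) :
    |∑ t ∈ Finset.range n, (u t).turn (u (t + 1))| = 2 := by
  -- By rotation, the path starts at its leftmost vertex.
  wlog hmin : ∀ t, p 0 ≤ p t generalizing p u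
  · obtain ⟨m, hm⟩ : ∃ m, ∀ t, p m ≤ p t := by
      have hne : (Set.range p).Nonempty := ⟨_, 0, rfl⟩
      obtain ⟨m, hm⟩ := Nat.sInf_mem hne
      exact ⟨m, fun t => hm ▸ Nat.sInf_le ⟨t, rfl⟩⟩
    have h := this (p := fun t => p (t + m)) (u := fun t => u (t + m))
      (fun t => by have := hp (t + m); rwa [show t + m + 1 = t + 1 + m by ring] at this)
      (fun t => by rw [← hpn (t + m)]; congr 1; ring)
      (fun t => by rw [← hun (t + m)]; congr 1; ring)
      (fun s t h => Nat.ModEq.add_right_cancel' m (hinj _ _ h))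
      (fun t => by simpa using hm (t + m))
    rw [← h]
    have := sum_periodic_shift (f := fun t => (u t).turn (u (t + 1))) (n := n)
      (fun t => by rw [hun, show t + n + 1 = t + 1 + n by ring, hun]) m
    rw [← this]
    simp only [show ∀ t, t + m + 1 = t + 1 + m from fun t => by ring]
  obtain ⟨n, rfl⟩ : ∃ k, n = k + 3 := ⟨n - 3, by omega⟩
  have hd : ∀ s t, s < t → t < s + (n + 3) → p s ≠ p t := by
    intro s t h1 h2 h
    have h3 := (Nat.modEq_iff_dvd' h1.le).1 (hinj _ _ h)
    have := Nat.le_of_dvd (by omega) h3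
    omega
  have h0 : ∀ a b d, (∃ s, a = p s) → (∃ s, b = p s) → wind (p 0) a b d = 0 := by
    rintro _ _ d ⟨s, rfl⟩ ⟨t, rfl⟩
    have := hmin s
    have := hmin t
    simp only [wind]
    split_ifs
    · omega
    · rfl
  have hp0 : p (n + 3) = p 0 := by simpa using hpn 0
  have hu0 : u (n + 3) = u 0 := by simpa using hun 0
  have hopf := sum_turn_of_simple (p := p) (u := u) (n + 1) (fun t _ => hp t)
    (fun s t h1 h2 => hd s t h1 (by omega))
  rw [Finset.sum_eq_zero (s := Finset.range (n + 1))
    (f := fun t => wind (p 0) (p (t + 1)) (p (t + 2)) (u (t + 1)))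
    (fun t _ => h0 _ _ _ ⟨_, rfl⟩ ⟨_, rfl⟩), zero_add,
    Finset.sum_range_succ' fun t => wind (p (n + 1 + 1)) (p t) (p (t + 1)) (u t)] at hopf
  -- Around the last vertex, the path winds as the square lemma and the vanishing of the winding
  -- around the leftmost vertex dictate.
  have tele : ∀ k ≤ n, ∑ t ∈ Finset.range k, wind (p (n + 2)) (p (t + 1)) (p (t + 2)) (u (t + 1)) =
      wind (p 1) (p (n + 2)) (p 0) (u (n + 2)) -
        wind (p (k + 1)) (p (n + 2)) (p 0) (u (n + 2)) := by
    intro k hk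
    induction k with
    | zero => simp
    | succ k ihk =>
      rw [Finset.sum_range_succ, ihk (by omega)]
      have hl := hp (n + 2)
      rw [hp0] at hl
      have := wind_square (hp (k + 1)) hl
        (hd (k + 1) (n + 2) (by omega) (by omega)) (hd 0 (k + 1) (by omega) (by omega)).symm
        (hd (k + 2) (n + 2) (by omega) (by omega)) (hd 0 (k + 2) (by omega) (by omega)).symm
      rw [h0 _ _ _ ⟨_, rfl⟩ ⟨_, rfl⟩] at this
      linarith
  have hl := hp (n + 2)
  rw [hp0] at hl
  have t1 := wind_add_wind (hp (n + 1)) hl (hd 0 (n + 1) (by omega) (by omega)).symm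
  rw [h0 _ _ _ ⟨_, rfl⟩ ⟨_, rfl⟩, add_zero] at t1
  have h1l := hd 1 (n + 2) (by omega) (by omega)
  have t2 := wind_add_wind hl (hp 0) h1l.symm
  -- The remaining contributions are the turn at the leftmost vertex, counted twice.
  have total : ∑ t ∈ Finset.range (n + 3), (u t).turn (u (t + 1)) =
      2 * (u (n + 2)).turn (u 0) := by
    rw [Finset.sum_range_succ, Finset.sum_range_succ, hopf, show n + 1 + 1 = n + 2 from rfl,
      tele n le_rfl, show n + 2 + 1 = n + 3 from rfl, hu0]
    simp only [zero_add] at t2 ⊢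
    linarith
  have hodd : (u (n + 2)).turn (u 0) = 1 ∨ (u (n + 2)).turn (u 0) = -1 := by
    have m1 := (hmin 1).lt_of_ne (hd 0 1 (by omega) (by omega))
    have m2 := (hmin (n + 2)).lt_of_ne (hd 0 (n + 2) (by omega) (by omega))
    have hs : G.Step (u 0) (p 0) (p 1) := hp 0
    have hbend : ∀ d : Dir, d.bend ≠ 0 → d.bend = 1 ∨ d.bend = -1 := by
      rintro ⟨_ | s, f⟩ h
      · exact absurd rfl h
      · simp only [Dir.bend]; split_ifs <;> simp
    -- An edge with a vertex strictly between its endpoints is an arc.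
    have harc : ∀ (d : Dir) (a b v : ℕ), G.Step d a b → ((a < v ∧ v < b) ∨ (b < v ∧ v < a)) →
        d.bend ≠ 0 := by
      rintro ⟨_ | s, f⟩ a b v h hv
      · cases f <;> simp only [Step] at h <;> have := (G.spine _ _).1 h <;> omega
      · simp only [Dir.bend]; split_ifs <;> simp
    rw [← t2]
    rcases lt_or_gt_of_ne h1l with hlt | hlt
    · have e1 : wind (p (n + 2)) (p 0) (p (0 + 1)) (u 0) = 0 := by
        simp only [wind, zero_add]; rw [if_neg]; omega
      have hb : (p (n + 2) < p 1 ∧ p 1 < p 0) ∨ (p 0 < p 1 ∧ p 1 < p (n + 2)) := by omega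
      rw [e1, zero_add, wind, zero_add, if_pos hb]
      exact hbend _ (harc _ _ _ _ hl hb)
    · have e1 : wind (p (0 + 1)) (p (n + 2)) (p 0) (u (n + 2)) = 0 := by
        simp only [wind, zero_add]; rw [if_neg]; omega
      have hb : (p 0 < p (n + 2) ∧ p (n + 2) < p 1) ∨ (p 1 < p (n + 2) ∧ p (n + 2) < p 0) := by
        omega
      rw [e1, add_zero, wind, zero_add, if_pos hb]
      exact hbend _ (harc _ _ _ _ hs hb)
  rw [total]
  rcases hodd with h | h <;> simp [h]

theorem _root_.Dir.abs_bend_le (d : Dir) : |d.bend| ≤ 1 := by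
  rcases d with ⟨_ | s, f⟩
  · simp [Dir.bend]
  · simp only [Dir.bend]; split_ifs <;> simp

theorem _root_.Dir.abs_turn_le (d e : Dir) : |d.turn e| ≤ 1 := by
  simp only [Dir.turn]
  split_ifs
  · simp
  · exact Dir.abs_bend_le d
  · exact Dir.abs_bend_le e

/-- A simple path winds around its first vertex only a bounded number of times, since each time an
edge passes around that vertex, one of its endpoints is one of the finitely many vertices to the
left. -/
theorem abs_sum_wind_le {p : ℕ → ℕ} (hinj : Function.Injective p) (u : ℕ → Dir) (n : ℕ) :
    |∑ t ∈ Finset.range n, wind (p 0) (p (t + 1)) (p (t + 2)) (u (t + 1))| ≤ 2 * p 0 := by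
  have hcard : ∀ k, (∑ t ∈ Finset.range n, if p (t + k) < p 0 then (1 : ℤ) else 0) ≤ p 0 := by
    intro k
    rw [Finset.sum_boole]
    have : ((Finset.range n).filter fun t => p (t + k) < p 0).card ≤ (Finset.range (p 0)).card :=
      Finset.card_le_card_of_injOn (fun t => p (t + k)) (fun t ht => by simp at ht ⊢; exact ht.2)
        (fun s _ t _ h => by simpa using hinj h)
    simpa using this
  refine (Finset.abs_sum_le_sum_abs _ _).trans ?_
  have hle : ∀ t ∈ Finset.range n, |wind (p 0) (p (t + 1)) (p (t + 2)) (u (t + 1))| ≤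
      (if p (t + 1) < p 0 then (1 : ℤ) else 0) + (if p (t + 2) < p 0 then (1 : ℤ) else 0) := by
    intro t _
    have := Dir.abs_bend_le (u (t + 1))
    simp only [wind]
    split_ifs <;> first | omega | simp
  refine (Finset.sum_le_sum hle).trans ?_
  rw [Finset.sum_add_distrib]
  have := hcard 1
  have := hcard 2
  omega

theorem sum_periodic {f : ℕ → ℤ} {n : ℕ} (hf : ∀ t, f (t + n) = f t) (k : ℕ) :
    ∑ t ∈ Finset.range (k * n), f t = k * ∑ t ∈ Finset.range n, f t := by
  induction k with
  | zero => simp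
  | succ k ih =>
    rw [Nat.succ_mul, Finset.sum_range_add, ih]
    have : ∑ t ∈ Finset.range n, f (k * n + t) = ∑ t ∈ Finset.range n, f t := by
      rw [← sum_periodic_shift hf (k * n)]
      exact Finset.sum_congr rfl fun t _ => by rw [add_comm]
    rw [this]
    push_cast
    ring

/-- An infinite simple path with periodic directions makes no turn in total over a period: otherwise
it would be a spiral, but it starts at a vertex with finitely many vertices to its left, and it
returns infinitely often to a vertex further to the right than all previous ones. -/
theorem sum_turn_eq_zero_of_injective {p : ℕ → ℕ} {u : ℕ → Dir} {n : ℕ} (hn : 0 < n)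
    (hp : ∀ t, G.Step (u t) (p t) (p (t + 1))) (hun : ∀ t, u (t + n) = u t)
    (hinj : Function.Injective p) :
    ∑ t ∈ Finset.range n, (u t).turn (u (t + 1)) = 0 := by
  set f : ℕ → ℤ := fun t => (u t).turn (u (t + 1)) with hf
  have hfn : ∀ t, f (t + n) = f t := fun t => by
    simp only [hf]; rw [hun, show t + n + 1 = t + 1 + n by ring, hun]
  have hrec : ∀ N₀, ∃ N ≥ N₀, ∀ s ≤ N, p s < p (N + 1) := by
    intro N₀
    obtain ⟨B, hB⟩ : ∃ B, ∀ s ≤ N₀, p s ≤ B :=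
      ⟨∑ s ∈ Finset.range (N₀ + 1), p s, fun s hs =>
        Finset.single_le_sum (f := p) (fun _ _ => Nat.zero_le _)
          (Finset.mem_range.2 (by omega))⟩
    have hex : ∃ N, B < p N := by
      by_contra! h
      exact Set.infinite_range_of_injective hinj
        ((Set.finite_Iic B).subset (by rintro _ ⟨t, rfl⟩; exact h t))
    classical
    have h1 := Nat.find_spec hex
    have h2 : ∀ s < Nat.find hex, p s ≤ B := fun s hs => not_lt.1 (Nat.find_min hex hs)
    have h3 : N₀ < Nat.find hex := by
      by_contra! h
      have := hB _ h
      omega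
    refine ⟨Nat.find hex - 1, by omega, fun s hs => ?_⟩
    rw [Nat.sub_add_cancel (by omega)]
    exact (h2 s (by omega)).trans_lt h1
  have hbound : ∀ N₀, ∃ N ≥ N₀, |∑ t ∈ Finset.range N, f t| ≤ 2 * p 0 := by
    intro N₀
    obtain ⟨N, hN, hmax⟩ := hrec N₀
    refine ⟨N, hN, ?_⟩
    have := sum_turn_of_simple (G := G) (p := p) (u := u) N (fun t _ => hp t)
      (fun s t h1 _ h => h1.ne (hinj h))
    simp only [hf]
    rw [this, Finset.sum_eq_zero (f := fun t => wind (p (N + 1)) (p t) (p (t + 1)) (u t)), add_zero]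
    · exact abs_sum_wind_le hinj u N
    · intro t ht
      rw [Finset.mem_range] at ht
      have := hmax t ht.le
      have := hmax (t + 1) ht
      simp only [wind]
      rw [if_neg]
      omega
  by_contra h0
  obtain ⟨N, hN, hle⟩ := hbound ((2 * p 0 + n + 1) * n)
  have hk : 2 * p 0 + n + 1 ≤ N / n := (Nat.le_div_iff_mul_le hn).2 hN
  have hsum : ∑ t ∈ Finset.range N, f t = (N / n : ℕ) * (∑ t ∈ Finset.range n, f t) +
      ∑ t ∈ Finset.range (N % n), f (N / n * n + t) := by
    rw [← sum_periodic hfn, ← Finset.sum_range_add, mul_comm, Nat.div_add_mod]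
  have hrest : |∑ t ∈ Finset.range (N % n), f (N / n * n + t)| ≤ n := by
    refine (Finset.abs_sum_le_sum_abs _ _).trans ?_
    refine (Finset.sum_le_card_nsmul _ _ 1 fun t _ => Dir.abs_turn_le _ _).trans ?_
    simp only [Finset.card_range, nsmul_eq_mul, mul_one]
    exact_mod_cast (Nat.mod_lt N hn).le
  have hone : 1 ≤ |∑ t ∈ Finset.range n, f t| := Int.one_le_abs h0
  have hmul : ((N / n : ℕ) : ℤ) ≤ |((N / n : ℕ) : ℤ) * ∑ t ∈ Finset.range n, f t| := by
    rw [abs_mul, Nat.abs_cast]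
    exact le_mul_of_one_le_right (by positivity) hone
  have htri : |((N / n : ℕ) : ℤ) * ∑ t ∈ Finset.range n, f t| ≤
      |∑ t ∈ Finset.range N, f t| + |∑ t ∈ Finset.range (N % n), f (N / n * n + t)| := by
    have := abs_sub (∑ t ∈ Finset.range N, f t) (∑ t ∈ Finset.range (N % n), f (N / n * n + t))
    rwa [hsum, add_sub_cancel_right, ← hsum] at this
  have hk' : ((2 * p 0 + n + 1 : ℕ) : ℤ) ≤ (N / n : ℕ) := by exact_mod_cast hk
  push_cast at hk'
  omega

/-- If a periodic sequence of directions describes a simple closed path in one two-page graph, then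
one period of it also closes up in any other two-page graph, provided that the infinite path
visits equal vertices only at times congruent modulo the period. -/
theorem closes_of_closed {H : TwoPage} {n : ℕ} (hn : 0 < n) {u : ℕ → Dir} {x y : ℕ → ℕ}
    (hun : ∀ t, u (t + n) = u t)
    (hx : ∀ t, G.Step (u t) (x t) (x (t + 1))) (hxn : ∀ t, x (t + n) = x t)
    (hxinj : ∀ s t, x s = x t → s ≡ t [MOD n])
    (hy : ∀ t, H.Step (u t) (y t) (y (t + 1))) (hyinj : ∀ s t, y s = y t → s ≡ t [MOD n]) :
    y n = y 0 := by
  by_contra hne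
  have hx0 : x n = x 0 := by simpa using hxn 0
  have hu0 : u n = u 0 := by simpa using hun 0
  have hturn : |∑ t ∈ Finset.range n, (u t).turn (u (t + 1))| = 2 := by
    rcases Nat.lt_or_ge n 3 with h3 | h3
    · obtain rfl | rfl : n = 1 ∨ n = 2 := by omega
      · exact absurd hx0.symm (hx 0).ne
      · -- A cycle of two edges: if the second one does not retrace the first, both turns have the
        -- same sign.
        have s0 := hx 0
        have s1 := hx 1
        rw [show 1 + 1 = 2 from rfl, hx0] at s1
        rw [zero_add] at s0
        have hinv : u 1 ≠ (u 0).inv := by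
          intro h
          have h1 := (hy 0).inv
          rw [← h] at h1
          exact hne ((hy 1).unique h1)
        rw [Finset.sum_range_succ, Finset.sum_range_one, show 1 + 1 = 2 from rfl, hu0]
        generalize u 0 = d at *
        simp only [zero_add]
        generalize u 1 = e at *
        have hde : d.2 ≠ e.2 := by
          rcases d with ⟨o, f⟩
          rcases e with ⟨o', f'⟩
          intro h
          cases f <;> cases f' <;> simp only [Step] at s0 s1 <;>
            first
              | exact absurd (edge_lt s0) (edge_lt s1).asymm
              | exact absurd h (by simp)
        clear * - hinv hde
        revert d e
        decide
    · exact sum_turn_of_closed h3 hx hxn hun hxinj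
  -- Steps are injective, so the path can be followed backwards from a repeated vertex.
  have hback : ∀ k a, y (a + k) = y a → y k = y 0 := by
    intro k a h
    induction a with
    | zero => simpa using h
    | succ a ih =>
      have hmod := hyinj _ _ h
      have hu : u (a + k) = u a := by
        have hk : n ∣ k := by
          have := (Nat.modEq_iff_dvd' (show a + 1 ≤ a + 1 + k by omega)).1 hmod.symm
          simpa using this
        obtain ⟨c, rfl⟩ := hk
        clear h hmod ih
        induction c with
        | zero => rfl
        | succ c ih => rw [show a + n * (c + 1) = a + n * c + n by ring, hun, ih]
      apply ih
      have h1 := hy (a + k)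
      rw [hu, show a + k + 1 = a + 1 + k by ring, h] at h1
      exact h1.injective (hy a)
  by_cases hinj : Function.Injective y
  · rw [sum_turn_eq_zero_of_injective hn hy hun hinj] at hturn
    simp at hturn
  · -- The path closes up after several periods, and then it has too large a turn.
    have hex : ∃ k, 0 < k ∧ y k = y 0 := by
      simp only [Function.Injective, not_forall] at hinj
      obtain ⟨a, b, hab, hne'⟩ := hinj
      wlog hlt : a < b generalizing a b
      · exact this b a hab.symm (Ne.symm hne') (by omega)
      exact ⟨b - a, by omega, hback (b - a) a (by rw [Nat.add_sub_cancel' hlt.le, hab])⟩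
    classical
    obtain ⟨hk0, hk⟩ := Nat.find_spec hex
    have hkmin : ∀ l, 0 < l → y l = y 0 → Nat.find hex ≤ l := fun l h1 h2 =>
      Nat.find_min' hex ⟨h1, h2⟩
    generalize Nat.find hex = k at *
    obtain ⟨c, rfl⟩ : n ∣ k := (Nat.modEq_zero_iff_dvd).1 (hyinj _ _ hk)
    have hc : 2 ≤ c := by
      by_contra! h
      obtain rfl | rfl : c = 0 ∨ c = 1 := by omega
      · simp at hk0
      · exact hne (by simpa using hk)
    have hu' : ∀ t, u (t + n * c) = u t := by
      intro t
      clear * - hun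
      induction c with
      | zero => rfl
      | succ c ih => rw [show t + n * (c + 1) = t + n * c + n by ring, hun, ih]
    have hy' : ∀ t, y (t + n * c) = y t := by
      intro t
      induction t with
      | zero => simpa using hk
      | succ t ih =>
        have h1 := hy (t + n * c)
        rw [hu', ih, show t + n * c + 1 = t + 1 + n * c by ring] at h1
        exact h1.unique (hy t)
    have hmod : ∀ s t, y s = y t → s ≡ t [MOD n * c] := by
      intro s t h
      wlog hle : s ≤ t generalizing s t
      · exact (this t s h.symm (by omega)).symm
      rw [Nat.modEq_iff_dvd' hle]
      have h1 : y (t - s) = y 0 := hback (t - s) s (by rw [Nat.add_sub_cancel' hle, h])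
      by_contra hnd
      have h2 : y ((t - s) % (n * c)) = y 0 := by
        rw [← h1]
        conv_rhs => rw [← Nat.mod_add_div (t - s) (n * c)]
        clear * - hy'
        induction (t - s) / (n * c) with
        | zero => simp
        | succ q ih => rw [ih, ← hy']; congr 1; ring
      have h3 := hkmin _ (Nat.pos_of_ne_zero fun h => hnd (Nat.dvd_of_mod_eq_zero h)) h2
      exact absurd (Nat.mod_lt (t - s) hk0) (by omega)
    have h2c : 2 ≤ n := by
      by_contra! h
      obtain rfl : n = 1 := by omega
      exact (hx 0).ne hx0.symm
    have := sum_turn_of_closed (by nlinarith) hy hy' hu' hmod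
    rw [mul_comm, sum_periodic (f := fun t => (u t).turn (u (t + 1)))
      (fun t => by rw [hun, show t + n + 1 = t + 1 + n by ring, hun]), abs_mul, hturn,
      Nat.abs_cast] at this
    omega

end TwoPage

/-! ### Nested words as two-page graphs -/

/-- The factor of length `k` of the sequence `f` that starts at position `a`. -/
def factor {α : Type*} (f : ℕ → α) (a k : ℕ) : List α := List.ofFn fun t : Fin k => f (a + t)

theorem factor_zero {α : Type*} (f : ℕ → α) (a : ℕ) : factor f a 0 = [] := by simp [factor]

theorem factor_succ {α : Type*} (f : ℕ → α) (a k : ℕ) :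
    factor f a (k + 1) = f a :: factor f (a + 1) k := by
  simp only [factor, List.ofFn_succ, Fin.val_zero, Fin.val_succ, add_zero]
  congr 2
  funext t
  congr 1
  ring

theorem length_factor {α : Type*} (f : ℕ → α) (a k : ℕ) : (factor f a k).length = k := by
  simp [factor]

theorem factor_add {α : Type*} (f : ℕ → α) (a k l : ℕ) :
    factor f a (k + l) = factor f a k ++ factor f (a + k) l := by
  induction k generalizing a with
  | zero => simp [factor_zero]
  | succ k ih =>
    rw [show k + 1 + l = k + l + 1 by ring, factor_succ, factor_succ, ih, List.cons_append,
      show a + 1 + k = a + (k + 1) by ring]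

namespace CallReturnAlphabet

variable {K : ℕ} (A : CallReturnAlphabet.{u} K)

open Classical in
/-- The change of height of stack `s` caused by a letter. -/
noncomputable def weight (s : Fin K) (a : A.Letter) : ℤ :=
  if a ∈ A.callsOf s then 1 else if a ∈ A.retsOf s then -1 else 0

variable {A}

theorem weight_call {s : Fin K} {a : A.Letter} (h : a ∈ A.callsOf s) : A.weight s a = 1 := by
  simp [weight, h]

theorem weight_ret {s : Fin K} {a : A.Letter} (h : a ∈ A.retsOf s) : A.weight s a = -1 := by
  have : a ∉ A.callsOf s := fun h' => by
    have h1 : A.kind a = _ := h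
    have h2 : A.kind a = _ := h'
    rw [h1] at h2
    cases h2
  simp [weight, h, this]

theorem WellFormed.sum_weight {s : Fin K} {w : List A.Letter} (h : A.WellFormed s w) :
    (w.map (A.weight s)).sum = 0 ∧ ∀ p, p <+: w → 0 ≤ (p.map (A.weight s)).sum := by
  induction h with
  | @wrap a b w ha hb _ ih =>
    refine ⟨by simp [weight_call ha, weight_ret hb, ih.1], fun p hp => ?_⟩
    rcases List.prefix_cons_iff.1 hp with rfl | ⟨t, rfl, ht⟩
    · simp
    · rcases List.prefix_concat_iff.1 ht with rfl | ht
      · simp [weight_call ha, weight_ret hb, ih.1]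
      · have := ih.2 t ht
        simp only [List.map_cons, List.sum_cons, weight_call ha]
        omega
  | append _ _ ih ih' =>
    refine ⟨by simp [ih.1, ih'.1], fun p hp => ?_⟩
    rcases le_total p.length (List.length _) with hl | hl
    · exact ih.2 p (List.prefix_of_prefix_length_le hp (List.prefix_append _ _) hl)
    · obtain ⟨t, rfl⟩ := List.prefix_of_prefix_length_le (List.prefix_append _ _) hp hl
      have := ih'.2 t ((List.prefix_append_right_inj _).1 hp)
      simpa [ih.1] using this
  | nil => simp
  | @other c hc hr =>
    have h0 : A.weight s c = 0 := by simp [weight, hc, hr]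
    refine ⟨by simp [h0], fun p hp => ?_⟩
    rcases List.prefix_cons_iff.1 hp with rfl | ⟨t, rfl, ht⟩
    · simp
    · simp [List.prefix_nil.1 ht, h0]

end CallReturnAlphabet

namespace InfNestedWord

section Height

variable {K : ℕ} {A : CallReturnAlphabet.{u} K} (W : InfNestedWord A)

/-- The height of stack `s` before position `k`, if unmatched returns decrease it below zero. -/
noncomputable def height (s : Fin K) (k : ℕ) : ℤ :=
  ∑ t ∈ Finset.range k, A.weight s (W.label t)

theorem sum_factor_weight (s : Fin K) (a k : ℕ) :
    ((factor W.label a k).map (A.weight s)).sum = W.height s (a + k) - W.height s a := by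
  induction k generalizing a with
  | zero => simp [factor_zero]
  | succ k ih =>
    have h : W.height s (a + 1) = W.height s a + A.weight s (W.label a) :=
      Finset.sum_range_succ _ _
    rw [factor_succ, List.map_cons, List.sum_cons, ih, h, show a + 1 + k = a + (k + 1) by ring]
    ring

/-- Between the ends of an edge of `mu` the stack does not fall below its initial height, to which
it returns at the end. -/
theorem mu_height {i j : ℕ} {s : Fin K} (h : W.mu i j) (hs : W.label i ∈ A.callsOf s) :
    i < j ∧ W.label j ∈ A.retsOf s ∧ W.height s (i + 1) = W.height s i + 1 ∧
    W.height s (j + 1) = W.height s j - 1 ∧ W.height s j = W.height s (i + 1) ∧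
    ∀ k, i < k → k ≤ j → W.height s (i + 1) ≤ W.height s k := by
  obtain ⟨s', hij, hc, hr, hw⟩ := (W.mu_iff i j).1 h
  obtain rfl : s' = s := by
    have h1 : A.kind (W.label i) = _ := hc
    have h2 : A.kind (W.label i) = _ := hs
    rw [h1] at h2
    cases h2
    rfl
  have hw' : A.WellFormed s' (factor W.label (i + 1) (j - (i + 1))) := hw
  obtain ⟨h0, hp⟩ := hw'.sum_weight
  refine ⟨hij, hr, ?_, ?_, ?_, ?_⟩
  · rw [height, Finset.sum_range_succ, CallReturnAlphabet.weight_call hs, height]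
  · rw [height, Finset.sum_range_succ, CallReturnAlphabet.weight_ret hr, height]
    ring
  · rw [sum_factor_weight, show i + 1 + (j - (i + 1)) = j by omega] at h0
    omega
  · intro k hk hkj
    have := hp (factor W.label (i + 1) (k - (i + 1))) (by
      rw [show j - (i + 1) = (k - (i + 1)) + (j - k) by omega, factor_add]
      exact List.prefix_append _ _)
    rw [sum_factor_weight, show i + 1 + (k - (i + 1)) = k by omega] at this
    omega

end Height

variable {A : CallReturnAlphabet.{u} 2} (W : InfNestedWord A)

/-- The two-page graph of an infinite nested word with two stacks, whose arcs are the edges of `mu`,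
drawn on the side of their stack. -/
def twoPage : TwoPage where
  edge
    | none, i, j => j = i + 1
    | some s, i, j => W.mu i j ∧ W.label i ∈ A.callsOf s
  spine _ _ := Iff.rfl
  arc_lt _ _ _ h := (W.mu_height h.1 h.2).1
  nest s a b c d h h' hac hcb := by
    obtain ⟨-, -, h1, h2, h3, h4⟩ := W.mu_height h.1 h.2
    obtain ⟨-, -, k1, k2, k3, k4⟩ := W.mu_height h'.1 h'.2
    have := h4 c hac hcb.le
    by_contra! hbd
    have := k4 b hcb hbd
    omega
  arc_right s a b c h h' := by
    obtain ⟨l1, -, h1, h2, h3, h4⟩ := W.mu_height h.1 h.2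
    obtain ⟨l2, -, k1, k2, k3, k4⟩ := W.mu_height h'.1 h'.2
    by_contra hne
    rcases lt_or_gt_of_ne hne with hlt | hlt
    · have := k4 (b + 1) (by omega) (by omega)
      omega
    · have := h4 (c + 1) (by omega) (by omega)
      omega

theorem mu_iff_exists_edge (i j : ℕ) : W.mu i j ↔ ∃ s, W.twoPage.edge (some s) i j := by
  constructor
  · intro h
    obtain ⟨s, -, hs, -⟩ := (W.mu_iff i j).1 h
    exact ⟨s, h, hs⟩
  · rintro ⟨s, h⟩
    exact h.1

end InfNestedWord

/-! ### Paths and observations -/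

namespace TwoPage

variable (G : TwoPage)

/-- Following the word `w` of directions leads from `i` to `j`. -/
def Path : List Dir → ℕ → ℕ → Prop
  | [], i, j => i = j
  | d :: w, i, j => ∃ k, G.Step d i k ∧ Path w k j

variable {G}

theorem path_append {w w' : List Dir} {i j : ℕ} :
    G.Path (w ++ w') i j ↔ ∃ k, G.Path w i k ∧ G.Path w' k j := by
  induction w generalizing i with
  | nil => simp [Path]
  | cons d w ih =>
    simp only [List.cons_append, Path, ih]
    constructor
    · rintro ⟨k, h, l, h1, h2⟩
      exact ⟨l, ⟨k, h, h1⟩, h2⟩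
    · rintro ⟨l, ⟨k, h, h1⟩, h2⟩
      exact ⟨k, h, l, h1, h2⟩

theorem path_singleton {d : Dir} {i j : ℕ} : G.Path [d] i j ↔ G.Step d i j := by simp [Path]

theorem Path.unique {w : List Dir} {i j k : ℕ} (h : G.Path w i j) (h' : G.Path w i k) :
    j = k := by
  induction w generalizing i with
  | nil => exact h.symm.trans h'
  | cons d w ih =>
    obtain ⟨l, h1, h2⟩ := h
    obtain ⟨l', h1', h2'⟩ := h'
    obtain rfl := h1.unique h1'
    exact ih h2 h2'

theorem Path.exists_reverse {w : List Dir} {i j : ℕ} (h : G.Path w i j) :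
    G.Path (w.map Dir.inv).reverse j i := by
  induction w generalizing i with
  | nil => exact Eq.symm h
  | cons d w ih =>
    obtain ⟨k, h1, h2⟩ := h
    rw [List.map_cons, List.reverse_cons, path_append]
    exact ⟨k, ih h2, path_singleton.2 h1.inv⟩

theorem path_factor {u : ℕ → Dir} {p : ℕ → ℕ} (a k : ℕ)
    (h : ∀ t, a ≤ t → t < a + k → G.Step (u t) (p t) (p (t + 1))) :
    G.Path (factor u a k) (p a) (p (a + k)) := by
  induction k generalizing a with
  | zero => simp [factor_zero, Path]
  | succ k ih =>
    rw [factor_succ]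
    refine ⟨p (a + 1), h a le_rfl (by omega), ?_⟩
    have := ih (a + 1) fun t h1 h2 => h t (by omega) (by omega)
    rwa [show a + 1 + k = a + (k + 1) by ring] at this

theorem exists_of_path_factor {u : ℕ → Dir} {k : ℕ} {i j : ℕ} (h : G.Path (factor u 0 k) i j) :
    ∃ p : ℕ → ℕ, p 0 = i ∧ p k = j ∧ ∀ t < k, G.Step (u t) (p t) (p (t + 1)) := by
  induction k generalizing j with
  | zero => exact ⟨fun _ => i, rfl, by simpa [factor_zero, Path] using h, by simp⟩
  | succ k ih =>
    rw [factor_add, path_append] at h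
    obtain ⟨l, h1, h2⟩ := h
    obtain ⟨p, p0, pk, hp⟩ := ih h1
    rw [factor_succ, factor_zero, path_singleton, zero_add] at h2
    refine ⟨fun t => if t ≤ k then p t else j, by simpa using p0, by simp, fun t ht => ?_⟩
    rcases Nat.lt_succ_iff_lt_or_eq.1 ht with hlt | rfl
    · simpa [hlt.le, Nat.succ_le_of_lt hlt] using hp t hlt
    · simpa [pk] using h2

variable (G)

open Classical in
/-- The value of the labelling `l` at the end of the path that starts at `i` and follows `w`, if
there is such a path. -/
noncomputable def obs {X : Type*} (l : ℕ → X) (i : ℕ) (w : List Dir) : Option X :=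
  if h : ∃ j, G.Path w i j then some (l h.choose) else none

/-- The labelling `l` separates distinct vertices connected by a path of length at most `m`. -/
def Separates {X : Type*} (l : ℕ → X) (m : ℕ) : Prop :=
  ∀ w i j, w.length ≤ m → G.Path w i j → l i = l j → i = j

variable {G}

section Obs

variable {X : Type*} {l : ℕ → X}

theorem Path.obs {w : List Dir} {i j : ℕ} (h : G.Path w i j) : G.obs l i w = some (l j) := by
  have hex : ∃ j, G.Path w i j := ⟨j, h⟩
  rw [TwoPage.obs, dif_pos hex, hex.choose_spec.unique h]

theorem obs_eq_some {w : List Dir} {i : ℕ} {x : X} :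
    G.obs l i w = some x ↔ ∃ j, G.Path w i j ∧ l j = x := by
  constructor
  · intro h
    rw [obs] at h
    split_ifs at h with hex
    exact ⟨_, hex.choose_spec, Option.some.inj h⟩
  · rintro ⟨j, h, rfl⟩
    exact h.obs

theorem obs_eq_none {w : List Dir} {i : ℕ} : G.obs l i w = none ↔ ∀ j, ¬G.Path w i j := by
  rw [obs]
  split_ifs with h
  · simpa using h
  · simpa using h

theorem obs_nil (i : ℕ) : G.obs l i [] = some (l i) := Path.obs rfl

theorem Step.obs_cons {d : Dir} {i j : ℕ} (h : G.Step d i j) (w : List Dir) :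
    G.obs l i (d :: w) = G.obs l j w := by
  have : ∀ k, G.Path (d :: w) i k ↔ G.Path w j k := fun k =>
    ⟨fun ⟨j', h1, h2⟩ => by rwa [h.unique h1], fun h2 => ⟨j, h, h2⟩⟩
  by_cases hex : ∃ k, G.Path w j k
  · obtain ⟨k, hk⟩ := hex
    rw [hk.obs, ((this k).2 hk).obs]
  · have hn : ∀ k, ¬G.Path w j k := fun k hk => hex ⟨k, hk⟩
    rw [obs_eq_none.2 hn, obs_eq_none.2 fun k => (this k).not.2 (hn k)]

theorem obs_cons_eq_none {d : Dir} {i : ℕ} (h : ∀ j, ¬G.Step d i j) (w : List Dir) :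
    G.obs l i (d :: w) = none :=
  obs_eq_none.2 fun _ ⟨j, h1, _⟩ => h j h1

end Obs

/-! ### Labellings that separate -/

/-- If every vertex sees along short paths what some vertex of a separated two-page graph sees, then
the labelling separates. In a counterexample of minimal length, the labels along the path are
pairwise distinct, so the path is a simple cycle in the other graph, and here it can be continued
periodically; hence it closes up. -/
theorem separates_of_obs {X : Type*} {l : ℕ → X} {m : ℕ}
    (h : ∀ i, ∃ (H : TwoPage) (l' : ℕ → X) (x : ℕ), H.Separates l' m ∧
      ∀ w : List Dir, w.length ≤ m + 1 → G.obs l i w = H.obs l' x w) :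
    G.Separates l m := by
  intro w
  induction hw : w.length using Nat.strong_induction_on generalizing w with
  | _ n ih =>
  intro i j hnm hpath hl
  by_contra hij
  have hn : 0 < n := by
    rcases Nat.eq_zero_or_pos n with rfl | h
    · rw [List.length_eq_zero_iff] at hw
      subst hw
      exact absurd hpath hij
    · exact h
  obtain ⟨u, hun, rfl⟩ : ∃ u : ℕ → Dir, (∀ t, u (t + n) = u t) ∧ w = factor u 0 n := by
    refine ⟨fun t => w[t % n]'(by rw [hw]; exact Nat.mod_lt t hn), fun t => by simp, ?_⟩
    refine List.ext_getElem (by simp [hw, length_factor]) fun t h1 h2 => ?_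
    simp [factor, Nat.mod_eq_of_lt (hw ▸ h1)]
  clear hw
  obtain ⟨p, rfl, rfl, hp⟩ := exists_of_path_factor hpath
  -- The infinite path that continues `p` periodically.
  obtain ⟨y, hy0, hy1⟩ : ∃ y : ℕ → ℕ, y 0 = p 0 ∧
      ∀ t k, G.Step (u t) (y t) k → y (t + 1) = k := by
    classical
    let next : Dir → ℕ → ℕ := fun d a => if h : ∃ k, G.Step d a k then h.choose else 0
    refine ⟨fun t => Nat.rec (p 0) (fun t a => next (u t) a) t, rfl, fun t k hk => ?_⟩
    have hex : ∃ k, G.Step (u t) (Nat.rec (p 0) (fun t a => next (u t) a) t) k := ⟨k, hk⟩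
    change next (u t) _ = k
    simp only [next, dif_pos hex]
    exact hex.choose_spec.unique hk
  have hyp : ∀ t ≤ n, y t = p t := by
    intro t ht
    induction t with
    | zero => exact hy0
    | succ t iht => exact hy1 _ _ (by rw [iht (by omega)]; exact hp t (by omega))
  -- The continuation by one more step is read off from a separated graph in which the vertex at
  -- time `N` has the same observations, and in which the last `n` steps form a cycle.
  have hext : ∀ N, (∀ t < N + n, G.Step (u t) (y t) (y (t + 1))) ∧
      ∀ t ≤ N, l (y t) = l (y (t + n)) := by
    intro N
    induction N with
    | zero =>
      refine ⟨fun t ht => ?_, fun t ht => ?_⟩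
      · rw [hyp t (by omega), hyp (t + 1) (by omega)]
        exact hp t (by omega)
      · obtain rfl : t = 0 := by omega
        rw [zero_add, hyp 0 (by omega), hyp n le_rfl, hl]
    | succ N ihN =>
      obtain ⟨hst, hlab⟩ := ihN
      obtain ⟨H, l', x, hsep, hobs⟩ := h (y N)
      have hP : G.Path (factor u N n) (y N) (y (N + n)) :=
        path_factor _ _ fun t _ h2 => hst t (by omega)
      obtain ⟨x', hx', hlx'⟩ := obs_eq_some.1
        ((hobs _ (by rw [length_factor]; omega)).symm.trans hP.obs)
      have hlx : l' x = l (y N) := by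
        have := hobs [] (by simp)
        rw [obs_nil, obs_nil] at this
        exact (Option.some.inj this).symm
      obtain rfl : x = x' := hsep _ _ _ (by rw [length_factor]; omega) hx'
        (by rw [hlx, hlx', hlab N le_rfl])
      obtain ⟨z, hz, hlz⟩ := obs_eq_some.1 ((hobs [u N] (by simp)).symm.trans
        (path_singleton.2 (hst N (by omega))).obs)
      obtain ⟨k, hk, hlk⟩ := obs_eq_some.1 ((hobs (factor u N n ++ [u N])
        (by simp [length_factor, hnm])).trans
        (path_append.2 ⟨x, hx', hz⟩ : H.Path (factor u N n ++ [u N]) x z).obs)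
      obtain ⟨k', hk1, hk2⟩ := path_append.1 hk
      obtain rfl := hP.unique hk1
      rw [path_singleton, ← hun N] at hk2
      have hyk := hy1 _ _ hk2
      refine ⟨fun t ht => ?_, fun t ht => ?_⟩
      · rcases (show t < N + n ∨ t = N + n by omega) with h1 | rfl
        · exact hst t h1
        · rwa [hyk]
      · rcases (show t ≤ N ∨ t = N + 1 by omega) with h1 | rfl
        · exact hlab t h1
        · rw [show N + 1 + n = N + n + 1 by ring, hyk, hlk, hlz]
  have hy : ∀ t, G.Step (u t) (y t) (y (t + 1)) := fun t => (hext t).1 t (by omega)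
  have hly : ∀ t, l (y t) = l (y (t + n)) := fun t => (hext t).2 t le_rfl
  have hclose : y n ≠ y 0 := by
    rw [hyp n le_rfl, hy0]
    exact Ne.symm hij
  -- The labels along one period are distinct, since otherwise a shorter word would do.
  have hlt : ∀ s t, s < t → t < n → l (y s) ≠ l (y t) := by
    intro s t hst htn hlab
    have h1 : y s = y t := by
      have := path_factor (G := G) (u := u) (p := y) s (t - s) fun a _ _ => hy a
      rw [Nat.add_sub_cancel' hst.le] at this
      exact ih (t - s) (by omega) _ (length_factor _ _ _) _ _ (by omega) this hlab
    have h2 := path_factor (G := G) (u := u) (p := y) 0 s fun a _ _ => hy a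
    have h3 := path_factor (G := G) (u := u) (p := y) t (n - t) fun a _ _ => hy a
    rw [zero_add, h1] at h2
    rw [Nat.add_sub_cancel' htn.le] at h3
    have h4 := path_append.2 ⟨_, h2, h3⟩
    refine hclose (ih _ ?_ _ rfl _ _ ?_ h4 ?_).symm
    · rw [List.length_append, length_factor, length_factor]; omega
    · rw [List.length_append, length_factor, length_factor]; omega
    · simpa using hly 0
  have hlmod : ∀ t, l (y t) = l (y (t % n)) := by
    intro t
    conv_lhs => rw [← Nat.mod_add_div t n]
    induction t / n with
    | zero => simp
    | succ q ihq => rw [← ihq, hly (t % n + n * q)]; congr 2; ring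
  have hinj : ∀ s t, l (y s) = l (y t) → s ≡ t [MOD n] := by
    intro s t hst
    rw [hlmod s, hlmod t] at hst
    by_contra hne
    rcases lt_or_gt_of_ne hne with h1 | h1
    · exact hlt _ _ h1 (Nat.mod_lt _ hn) hst
    · exact hlt _ _ h1 (Nat.mod_lt _ hn) hst.symm
  -- The corresponding cycle in a separated graph.
  obtain ⟨H, l', x, hsep, hobs⟩ := h (y 0)
  have hP : ∀ t, G.Path (factor u 0 t) (y 0) (y t) := fun t => by
    have := path_factor (G := G) (u := u) (p := y) 0 t fun a _ _ => hy a
    rwa [zero_add] at this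
  obtain ⟨x', hx', hlx'⟩ := obs_eq_some.1
    ((hobs _ (by rw [length_factor]; omega)).symm.trans (hP n).obs)
  obtain ⟨z, hz0, hzn, hz⟩ := exists_of_path_factor hx'
  have hlz : ∀ t ≤ n, l' (z t) = l (y t) := by
    intro t ht
    have h1 := path_factor (G := H) (u := u) (p := z) 0 t fun a _ _ => hz a (by omega)
    rw [zero_add, hz0] at h1
    have h2 := hobs (factor u 0 t) (by rw [length_factor]; omega)
    rw [(hP t).obs, h1.obs] at h2
    exact (Option.some.inj h2).symm
  have hz_closed : z n = z 0 := by
    refine (hsep _ _ _ (by rw [length_factor]; exact hnm) (hz0 ▸ hzn ▸ hx') ?_).symm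
    rw [hlz 0 (by omega), hlz n le_rfl]
    simpa using hly 0
  refine hclose (closes_of_closed (G := H) hn (x := fun t => z (t % n)) hun ?_ ?_ ?_ hy
    fun s t h => hinj s t (by rw [h]))
  · intro t
    have hu : u t = u (t % n) := by
      conv_lhs => rw [← Nat.mod_add_div t n]
      induction t / n with
      | zero => simp
      | succ q ihq => rw [← ihq, ← hun (t % n + n * q)]; congr 1; ring
    have h1 := hz (t % n) (Nat.mod_lt _ hn)
    rw [hu]
    have h2 : z ((t + 1) % n) = z (t % n + 1) := by
      rw [← Nat.mod_add_mod]
      rcases (Nat.succ_le_of_lt (Nat.mod_lt t hn)).lt_or_eq with h2 | h2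
      · rw [Nat.mod_eq_of_lt h2]
      · rw [show t % n + 1 = n from h2, Nat.mod_self, hz_closed]
    simpa only [h2] using h1
  · intro t
    simp
  · intro s t hst
    refine hinj s t ?_
    rw [hlmod s, hlmod t, ← hlz _ (Nat.mod_lt _ hn).le, ← hlz _ (Nat.mod_lt _ hn).le]
    exact congrArg l' hst

end TwoPage

namespace TwoPage

/-- A colouring of `ℕ` chosen greedily: the colour of `i` is picked in view of the colours of the
smaller numbers related to `i`. -/
noncomputable def greedy {C : Type*} (R : ℕ → ℕ → Prop) (pick : Set C → C) : ℕ → C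
  | i => pick {c | ∃ j, ∃ _ : j < i, R j i ∧ greedy R pick j = c}

/-- Since vertices have bounded degree, a bounded number of colours suffices for a labelling that
separates all two-page graphs. -/
theorem exists_separates (m : ℕ) :
    ∃ M : ℕ, ∀ G : TwoPage, ∃ l : ℕ → Fin (M + 1), G.Separates l m := by
  have hfin : {w : List Dir | w.length ≤ m}.Finite := List.finite_length_le Dir m
  refine ⟨{w : List Dir | w.length ≤ m}.ncard, fun G => ?_⟩
  set M := {w : List Dir | w.length ≤ m}.ncard
  have hpick : ∀ s : Set (Fin (M + 1)), ∃ c, s.ncard ≤ M → c ∉ s := by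
    intro s
    by_cases hs : s.ncard ≤ M
    · have hne : s ≠ Set.univ := by
        rintro rfl
        rw [Set.ncard_univ, Nat.card_fin] at hs
        omega
      obtain ⟨c, hc⟩ := (Set.ne_univ_iff_exists_notMem s).1 hne
      exact ⟨c, fun _ => hc⟩
    · exact ⟨0, fun h => absurd h hs⟩
  choose pick hpick using hpick
  let R : ℕ → ℕ → Prop := fun j i => ∃ w : List Dir, w.length ≤ m ∧ G.Path w i j
  have hcard : ∀ i, {c | ∃ j, ∃ _ : j < i, R j i ∧ greedy R pick j = c}.ncard ≤ M := by
    intro i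
    classical
    let f : List Dir → Fin (M + 1) := fun w =>
      if h : ∃ j, G.Path w i j then greedy R pick h.choose else 0
    refine (Set.ncard_le_ncard ?_ (hfin.image f)).trans (Set.ncard_image_le hfin)
    rintro _ ⟨j, -, ⟨w, hw, hp⟩, rfl⟩
    have hex : ∃ j, G.Path w i j := ⟨j, hp⟩
    exact ⟨w, hw, by simp only [f, dif_pos hex, hex.choose_spec.unique hp]⟩
  have hlt : ∀ i j, j < i → R j i → greedy R pick j ≠ greedy R pick i := by
    intro i j hji hR heq
    have h := hpick _ (hcard i)
    rw [greedy] at heq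
    rw [greedy] at heq
    apply h
    rw [← heq]
    exact ⟨j, hji, hR, by rw [greedy]⟩
  refine ⟨greedy R pick, fun w i j hw hp heq => ?_⟩
  by_contra hne
  rcases lt_or_gt_of_ne hne with h | h
  · refine hlt j i h ⟨_, ?_, hp.exists_reverse⟩ heq
    simpa using hw
  · exact hlt i j h ⟨w, hw, hp⟩ heq.symm

section Transfer

variable {G H : TwoPage} {X : Type*} {l l' : ℕ → X} {m i x : ℕ}

/-- If two words lead to the same vertex in one graph, then they do so in any separated graph with
the same observations. -/
theorem eq_of_obs (hG : G.Separates l m) {w w' : List Dir} (hm : w.length + w'.length ≤ m)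
    (hw : G.obs l i w = H.obs l' x w) (hw' : G.obs l i w' = H.obs l' x w') {j j' y : ℕ}
    (h1 : H.Path w x y) (h2 : H.Path w' x y) (h3 : G.Path w i j) (h4 : G.Path w' i j') :
    j = j' := by
  rw [h1.obs, h3.obs] at hw
  rw [h2.obs, h4.obs, ← hw] at hw'
  exact hG ((w.map Dir.inv).reverse ++ w') j j' (by simpa using hm)
    (path_append.2 ⟨i, h3.exists_reverse, h4⟩) (Option.some.inj hw').symm

theorem step_of_obs (hG : G.Separates l m) {w w' : List Dir} {d : Dir}
    (hm : w.length + 1 + w'.length ≤ m)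
    (hw : G.obs l i (w ++ [d]) = H.obs l' x (w ++ [d])) (hw' : G.obs l i w' = H.obs l' x w')
    {j j' y y' : ℕ} (h1 : H.Path w x y) (h2 : H.Path w' x y') (h3 : G.Path w i j)
    (h4 : G.Path w' i j') (hd : H.Step d y y') : G.Step d j j' := by
  have h5 : H.Path (w ++ [d]) x y' := path_append.2 ⟨y, h1, path_singleton.2 hd⟩
  obtain ⟨k, hk, -⟩ := obs_eq_some.1 (hw.trans h5.obs)
  obtain rfl := eq_of_obs hG (by simpa using hm) hw hw' h5 h2 hk h4
  obtain ⟨j'', h6, h7⟩ := path_append.1 hk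
  rw [h3.unique h6]
  exact path_singleton.1 h7

end Transfer

end TwoPage

/-! ### Spheres -/

namespace InfNestedWord

section Prefix

variable {K : ℕ} {A : CallReturnAlphabet.{u} K}

/-- The nested word on the first `n` positions of an infinite nested word. -/
def take (W : InfNestedWord A) (n : ℕ) (hn : 0 < n) : NestedWord A n where
  succ i j := W.succ i j
  mu i j := W.mu i j
  label i := W.label i
  pos := hn
  succ_iff i j := W.succ_iff i j
  mu_iff i j := W.mu_iff i j

theorem take_gaifman_adj (W : InfNestedWord A) (n : ℕ) (hn : 0 < n) (i j : Fin n) :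
    (W.take n hn).gaifman.Adj i j ↔ W.gaifman.Adj i j := by
  simp [LabeledStructure.gaifman, SimpleGraph.fromRel_adj, take, Fin.ext_iff]

theorem _root_.LabeledStructure.mem_ball_iff_exists_walk {L N : Type*} (S : LabeledStructure L N)
    (r : ℕ) (i j : N) : j ∈ S.ball r i ↔ ∃ p : S.gaifman.Walk i j, p.length ≤ r := by
  constructor
  · intro h
    obtain ⟨p, hp⟩ := SimpleGraph.exists_walk_of_edist_ne_top
      (ne_top_of_le_ne_top (ENat.natCast_ne_top r) h)
    refine ⟨p, ?_⟩
    have h' : S.gaifman.edist i j ≤ r := h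
    rw [← hp] at h'
    exact_mod_cast h'
  · rintro ⟨p, hp⟩
    exact p.edist_le.trans (by exact_mod_cast hp)

theorem exists_take_walk (W : InfNestedWord A) (n : ℕ) (hn : 0 < n) {a b : ℕ}
    (p : W.gaifman.Walk a b) (hp : ∀ v ∈ p.support, v < n) (ha : a < n) (hb : b < n) :
    ∃ q : (W.take n hn).gaifman.Walk ⟨a, ha⟩ ⟨b, hb⟩, q.length = p.length := by
  induction p with
  | nil => exact ⟨.nil, rfl⟩
  | @cons a c b hadj p ih =>
    have hc : c < n := hp c (by simp)
    obtain ⟨q, hq⟩ := ih (fun v hv => hp v (by simp [hv])) hc hb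
    exact ⟨.cons ((W.take_gaifman_adj n hn ⟨a, ha⟩ ⟨c, hc⟩).2 hadj) q, by simp [hq]⟩

/-- If the sphere around `i` lies within the first `n` positions, then it is also a sphere of the
finite nested word on these positions. -/
theorem sphere_mem_spheres_of_lt (W : InfNestedWord A) (r i n : ℕ)
    (h : ∀ j ∈ W.ball r i, j < n) : W.sphere r i ∈ Spheres A r := by
  have hi : i < n := h i (by simp [LabeledStructure.ball])
  have hn : 0 < n := by omega
  have hball : ∀ k : Fin n, k ∈ (W.take n hn).ball r ⟨i, hi⟩ ↔ (k : ℕ) ∈ W.ball r i := by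
    intro k
    rw [LabeledStructure.mem_ball_iff_exists_walk, LabeledStructure.mem_ball_iff_exists_walk]
    constructor
    · rintro ⟨p, hp⟩
      let f : (W.take n hn).gaifman →g W.gaifman :=
        ⟨fun k => k, fun {a b} hab => (W.take_gaifman_adj n hn a b).1 hab⟩
      exact ⟨p.map f, by simpa using hp⟩
    · rintro ⟨p, hp⟩
      have hs : ∀ v ∈ p.support, v < n := fun v hv => by
        classical
        exact h v ((LabeledStructure.mem_ball_iff_exists_walk _ _ _ _).2
          ⟨p.takeUntil v hv, (p.length_takeUntil_le_length hv).trans hp⟩)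
      obtain ⟨q, hq⟩ := W.exists_take_walk n hn p hs hi k.2
      exact ⟨q, hq.trans_le hp⟩
  refine ⟨n, W.take n hn, ⟨i, hi⟩, ?_⟩
  refine ⟨⟨fun x => ⟨⟨x.1, h x.1 x.2⟩, (hball _).2 x.2⟩, fun x => ⟨x.1, (hball _).1 x.2⟩,
    fun _ => rfl, fun _ => rfl⟩, fun _ _ => Iff.rfl, fun _ _ => Iff.rfl, fun _ => rfl, rfl⟩

end Prefix

variable {A : CallReturnAlphabet.{u} 2}

theorem gaifman_adj_iff (W : InfNestedWord A) (i j : ℕ) :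
    W.gaifman.Adj i j ↔ ∃ d, W.twoPage.Step d i j := by
  rw [LabeledStructure.gaifman, SimpleGraph.fromRel_adj]
  constructor
  · rintro ⟨-, (h | h) | (h | h)⟩
    · exact ⟨(none, true), (W.succ_iff i j).1 h⟩
    · obtain ⟨s, hs⟩ := (W.mu_iff_exists_edge i j).1 h
      exact ⟨(some s, true), hs⟩
    · exact ⟨(none, false), (W.succ_iff j i).1 h⟩
    · obtain ⟨s, hs⟩ := (W.mu_iff_exists_edge j i).1 h
      exact ⟨(some s, false), hs⟩
  · rintro ⟨⟨_ | s, _ | _⟩, h⟩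
    · exact ⟨h.ne, Or.inr (Or.inl ((W.succ_iff j i).2 h))⟩
    · exact ⟨h.ne, Or.inl (Or.inl ((W.succ_iff i j).2 h))⟩
    · exact ⟨h.ne, Or.inr (Or.inr ((W.mu_iff_exists_edge j i).2 ⟨s, h⟩))⟩
    · exact ⟨h.ne, Or.inl (Or.inr ((W.mu_iff_exists_edge i j).2 ⟨s, h⟩))⟩

theorem mem_ball_iff_exists_path (W : InfNestedWord A) (r i j : ℕ) :
    j ∈ W.ball r i ↔ ∃ w : List Dir, w.length ≤ r ∧ W.twoPage.Path w i j := by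
  rw [LabeledStructure.mem_ball_iff_exists_walk]
  constructor
  · rintro ⟨p, hp⟩
    suffices h : ∃ w : List Dir, w.length = p.length ∧ W.twoPage.Path w i j by
      obtain ⟨w, hw, h⟩ := h
      exact ⟨w, hw.trans_le hp, h⟩
    clear hp
    induction p with
    | nil => exact ⟨[], rfl, rfl⟩
    | cons hadj p ih =>
      obtain ⟨w, hw, h⟩ := ih
      obtain ⟨d, hd⟩ := (W.gaifman_adj_iff _ _).1 hadj
      exact ⟨d :: w, by simp [hw], _, hd, h⟩
  · rintro ⟨w, hw, h⟩
    suffices h : ∃ p : W.gaifman.Walk i j, p.length = w.length by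
      obtain ⟨p, hp⟩ := h
      exact ⟨p, hp.trans_le hw⟩
    clear hw
    induction w generalizing i with
    | nil =>
      obtain rfl : i = j := h
      exact ⟨.nil, rfl⟩
    | cons d w ih =>
      obtain ⟨k, hk, h⟩ := h
      obtain ⟨p, hp⟩ := ih _ h
      exact ⟨.cons ((W.gaifman_adj_iff _ _).2 ⟨d, hk⟩) p, by simp [hp]⟩

theorem sphere_mem_spheres (W : InfNestedWord A) (r i : ℕ) : W.sphere r i ∈ Spheres A r := by
  have hfin : (W.ball r i).Finite := by
    classical
    refine ((List.finite_length_le Dir r).image fun w =>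
      if h : ∃ j, W.twoPage.Path w i j then h.choose else 0).subset fun j hj => ?_
    obtain ⟨w, hw, hp⟩ := (W.mem_ball_iff_exists_path r i j).1 hj
    have hex : ∃ j, W.twoPage.Path w i j := ⟨j, hp⟩
    exact ⟨w, hw, by simp only [dif_pos hex, hex.choose_spec.unique hp]⟩
  obtain ⟨B, hB⟩ := hfin.bddAbove
  exact W.sphere_mem_spheres_of_lt r i (B + 1) fun j hj => Nat.lt_succ_of_le (hB hj)

/-- The observations along short paths determine the sphere, if they separate. -/
theorem sphere_isomorphic_of_obs {V W : InfNestedWord A} {r x i : ℕ} {X : Type*} {l l' : ℕ → X}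
    (π : X → A.Letter) (hl : ∀ j, W.label j = π (l j)) (hl' : ∀ j, V.label j = π (l' j))
    (hW : W.twoPage.Separates l (2 * r + 1)) (hV : V.twoPage.Separates l' (2 * r + 1))
    (h : ∀ w : List Dir, w.length ≤ r + 1 → W.twoPage.obs l i w = V.twoPage.obs l' x w) :
    (V.sphere r x).Isomorphic (W.sphere r i) := by
  have hto : ∀ y : V.ball r x, ∃ j : W.ball r i, ∃ w : List Dir, w.length ≤ r ∧
      V.twoPage.Path w x y ∧ W.twoPage.Path w i j := by
    rintro ⟨y, hy⟩
    obtain ⟨w, hw, hp⟩ := (V.mem_ball_iff_exists_path r x y).1 hy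
    obtain ⟨j, hj, -⟩ := TwoPage.obs_eq_some.1 ((h w (by omega)).trans hp.obs)
    exact ⟨⟨j, (W.mem_ball_iff_exists_path r i j).2 ⟨w, hw, hj⟩⟩, w, hw, hp, hj⟩
  choose f wd hwd hfV hfW using hto
  have hinj : Function.Injective f := by
    intro y y' hyy
    have h1 := hfW y'
    rw [← hyy] at h1
    have := hwd y
    have := hwd y'
    exact Subtype.ext (TwoPage.eq_of_obs hV (by omega) (h _ (by omega)).symm
      (h _ (by omega)).symm (hfW y) h1 (hfV y) (hfV y'))
  have hsurj : Function.Surjective f := by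
    rintro ⟨j, hj⟩
    obtain ⟨w, hw, hp⟩ := (W.mem_ball_iff_exists_path r i j).1 hj
    obtain ⟨y, hy, -⟩ := TwoPage.obs_eq_some.1 ((h w (by omega)).symm.trans hp.obs)
    refine ⟨⟨y, (V.mem_ball_iff_exists_path r x y).2 ⟨w, hw, hy⟩⟩, Subtype.ext ?_⟩
    have := hwd ⟨y, (V.mem_ball_iff_exists_path r x y).2 ⟨w, hw, hy⟩⟩
    exact TwoPage.eq_of_obs hW (by omega) (h _ (by omega)) (h _ (by omega)) (hfV _) hy (hfW _) hp
  have hstep : ∀ (d : Dir) (y y' : V.ball r x),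
      V.twoPage.Step d y y' ↔ W.twoPage.Step d (f y) (f y') := by
    intro d y y'
    have h1 := hwd y
    have h2 := hwd y'
    have h3 := h (wd y ++ [d]) (by simpa using h1)
    have h4 := h (wd y') (by omega)
    exact ⟨TwoPage.step_of_obs hW (by omega) h3 h4 (hfV y) (hfV y') (hfW y) (hfW y'),
      TwoPage.step_of_obs hV (by omega) h3.symm h4.symm (hfW y) (hfW y') (hfV y) (hfV y')⟩
  refine ⟨Equiv.ofBijective f ⟨hinj, hsurj⟩, fun y y' => ?_, fun y y' => ?_,
    fun (y : V.ball r x) => ?_, ?_⟩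
  · exact (V.succ_iff _ _).trans ((hstep (none, true) y y').trans (W.succ_iff _ _).symm)
  · refine (V.mu_iff_exists_edge _ _).trans (Iff.trans ?_ (W.mu_iff_exists_edge _ _).symm)
    exact exists_congr fun s => hstep (some s, true) y y'
  · change V.label y = W.label (f y)
    have := h (wd y) (by have := hwd y; omega)
    rw [(hfV y).obs, (hfW y).obs] at this
    exact (hl' y).trans ((congrArg π (Option.some.inj this)).symm.trans (hl (f y)).symm)
  · refine Subtype.ext ?_
    let c : V.ball r x := (V.sphere r x).center
    have hc : V.twoPage.Path [] x c := rfl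
    have := hwd c
    exact TwoPage.eq_of_obs hW (w' := []) (by simp; omega) (h _ (by omega)) (h _ (by simp))
      (hfV c) hc (hfW c) rfl

end InfNestedWord

/-! ### The automaton -/

section Automaton

variable {A : CallReturnAlphabet.{u} 2} {X : Type} {π : X → A.Letter} {m : ℕ}

/-- The view `f` consists of the observations along the words of length at most `m + 1` that are
made at position `x` of the infinite nested word `V` with the labelling `l`, which refines the
labelling by letters and separates positions connected by a path of length at most `m`. -/
def IsViewOf (π : X → A.Letter) (m : ℕ) (f : {w : List Dir // w.length ≤ m + 1} → Option X)
    (V : InfNestedWord A) (l : ℕ → X) (x : ℕ) : Prop :=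
  (∀ j, V.label j = π (l j)) ∧ V.twoPage.Separates l m ∧ ∀ w, f w = V.twoPage.obs l x w

/-- The views that occur in some infinite nested word. -/
def View (π : X → A.Letter) (m : ℕ) : Type :=
  {f : {w : List Dir // w.length ≤ m + 1} → Option X // ∃ V l x, IsViewOf π m f V l x}

namespace View

/-- If the second view is taken from the position that a step in direction `d` reaches from the
position of the first, then each of the two views contains what the other one requires of it. -/
def Compat (d : Dir) (f g : View π m) : Prop :=
  ∀ (w : List Dir) (hw : w.length ≤ m),
    f.1 ⟨d :: w, Nat.succ_le_succ hw⟩ = g.1 ⟨w, Nat.le_succ_of_le hw⟩ ∧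
    g.1 ⟨d.inv :: w, Nat.succ_le_succ hw⟩ = f.1 ⟨w, Nat.le_succ_of_le hw⟩

/-- The view contains no step in direction `d`. -/
def Blocked (d : Dir) (f : View π m) : Prop := f.1 ⟨[d], Nat.succ_le_succ (Nat.zero_le m)⟩ = none

theorem exists_label (f : View π m) : ∃ c : X, f.1 ⟨[], Nat.zero_le _⟩ = some c := by
  obtain ⟨V, l, x, -, -, h⟩ := f.2
  exact ⟨_, (h _).trans (TwoPage.obs_nil x)⟩

/-- The label of the position from which a view is taken. -/
noncomputable def label (f : View π m) : X := f.exists_label.choose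

theorem val_nil (f : View π m) : f.1 ⟨[], Nat.zero_le _⟩ = some f.label :=
  f.exists_label.choose_spec

theorem Blocked.val_cons {d : Dir} {f : View π m} (h : f.Blocked d) {w : List Dir}
    (hw : (d :: w).length ≤ m + 1) : f.1 ⟨d :: w, hw⟩ = none := by
  obtain ⟨V, l, x, -, -, hf⟩ := f.2
  rw [Blocked, hf, TwoPage.obs_eq_none] at h
  rw [hf]
  exact TwoPage.obs_cons_eq_none (fun j hj => h j (TwoPage.path_singleton.2 hj)) w

/-- A view that contains a step along an arc of stack `s` is taken from a call of that stack. -/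
theorem mem_callsOf_of_not_blocked {s : Fin 2} {f : View π m} (h : ¬f.Blocked (some s, true)) :
    π f.label ∈ A.callsOf s := by
  obtain ⟨V, l, x, hl, -, hf⟩ := f.2
  rw [Blocked, hf, TwoPage.obs_eq_none] at h
  push Not at h
  obtain ⟨y, hy⟩ := h
  have h0 := hf ⟨[], Nat.zero_le _⟩
  rw [val_nil, TwoPage.obs_nil] at h0
  rw [Option.some.inj h0, ← hl]
  exact (TwoPage.path_singleton.1 hy).2

end View

/-- The automaton whose states are views, with an additional mark for the states before the first
letter; every state is final. A transition checks that the views at the ends of an edge are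
compatible, and that the view at a position contains no arc to the left unless this arc has been
read. That a view contains an arc to the right only if there is one is left to the calling
states. -/
def viewAutomaton [Finite X] (π : X → A.Letter) (m : ℕ) : GenNWA A where
  Q := View π m × Bool
  finite_Q := by
    have : Finite {w : List Dir // w.length ≤ m + 1} :=
      (List.finite_length_le Dir (m + 1)).to_subtype
    have : Finite (View π m) := Subtype.finite
    infer_instance
  δ₁ := {t | t.2.2.2 = false ∧ π t.2.2.1.label = t.2.1 ∧
    (∀ s, t.2.2.1.Blocked (some s, false)) ∧
    (t.1.2 = true → t.2.2.1.Blocked (none, false)) ∧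
    (t.1.2 = false → t.1.1.Compat (none, true) t.2.2.1)}
  δ₂ := {t | t.2.2.1 ∈ A.rets ∧ t.2.2.2.2 = false ∧ π t.2.2.2.1.label = t.2.2.1 ∧
    t.2.1.1.Compat (none, true) t.2.2.2.1 ∧
    ∃ s, t.2.2.1 ∈ A.retsOf s ∧ t.1.1.Compat (some s, true) t.2.2.2.1 ∧
      ∀ s', s' ≠ s → t.2.2.2.1.Blocked (some s', false)}
  δ₂_ret _ _ _ _ h := h.1
  init := {q | q.2 = true}
  final := Set.univ
  calling := {q | ∃ s, ¬q.1.Blocked (some s, true)}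

theorem CallReturnAlphabet.retsOf_unique {a : A.Letter} {s s' : Fin 2} (h : a ∈ A.retsOf s)
    (h' : a ∈ A.retsOf s') :
    s = s' := by
  have h1 : A.kind a = _ := h
  have h2 : A.kind a = _ := h'
  rw [h1] at h2
  cases h2
  rfl

theorem InfNestedWord.edge_mem_retsOf (W : InfNestedWord A) {s : Fin 2} {i j : ℕ}
    (h : W.twoPage.edge (some s) i j) : W.label j ∈ A.retsOf s :=
  (W.mu_height h.1 h.2).2.1

/-- The views of a separating labelling form an accepting run. -/
theorem mem_omegaLanguage [Finite X] {W : InfNestedWord A} {l : ℕ → X}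
    (hl : ∀ j, W.label j = π (l j)) (hsep : W.twoPage.Separates l m) :
    W ∈ (viewAutomaton π m).omegaLanguage := by
  let view : ℕ → View π m := fun i =>
    ⟨fun w => W.twoPage.obs l i w, W, l, i, hl, hsep, fun _ => rfl⟩
  have hlabel : ∀ i, π (view i).label = W.label i := fun i => by
    have h := (view i).val_nil
    change W.twoPage.obs l i [] = _ at h
    rw [TwoPage.obs_nil] at h
    rw [← Option.some.inj h, hl]
  have hcompat : ∀ o i j, W.twoPage.edge o i j → (view i).Compat (o, true) (view j) := by
    intro o i j h w hw
    have hs : W.twoPage.Step (o, true) i j := h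
    exact ⟨hs.obs_cons w, hs.inv.obs_cons w⟩
  have hblocked : ∀ d i, (∀ j, ¬W.twoPage.Step d i j) → (view i).Blocked d :=
    fun d i h => TwoPage.obs_cons_eq_none h []
  have hnot : ∀ d i, ¬(view i).Blocked d → ∃ j, W.twoPage.Step d i j := by
    intro d i h
    by_contra! h'
    exact h (hblocked d i h')
  refine ⟨fun i => (view i, false), ⟨⟨(view 0, true), rfl, rfl, hlabel 0, fun s => ?_,
    fun _ => ?_, nofun⟩,
    fun i => ⟨fun c hr hc => ?_, fun hn => ?_⟩⟩, ?_, ?_⟩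
  · exact hblocked _ _ fun j hj => absurd (TwoPage.edge_lt (G := W.twoPage) hj) (by omega)
  · exact hblocked _ _ fun j hj => absurd (TwoPage.edge_lt (G := W.twoPage) hj) (by omega)
  · obtain ⟨s, hs⟩ := (W.mu_iff_exists_edge _ _).1 hc
    refine ⟨hr, rfl, hlabel _, hcompat _ _ _ rfl, s, W.edge_mem_retsOf hs, hcompat _ _ _ hs,
      fun s' hne => hblocked _ _ fun j hj => hne ?_⟩
    exact CallReturnAlphabet.retsOf_unique (W.edge_mem_retsOf hj) (W.edge_mem_retsOf hs)
  · refine ⟨rfl, hlabel _, fun s => hblocked _ _ fun j hj => hn ?_, nofun,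
      fun _ => hcompat _ _ _ rfl⟩
    exact ⟨Set.mem_iUnion.2 ⟨s, W.edge_mem_retsOf hj⟩, j, hj.1⟩
  · exact Set.infinite_univ.mono fun _ _ => trivial
  · rintro i ⟨s, hs⟩
    obtain ⟨j, hj⟩ := hnot _ _ hs
    exact ⟨Set.mem_iUnion.2 ⟨s, hj.2⟩, j, hj.1⟩

/-- In an accepting run, every state is the view of its position with respect to the labelling
guessed by the run. -/
theorem obs_of_isAcceptingRun [Finite X] {W : InfNestedWord A}
    {ρ : ℕ → (viewAutomaton π m).Q} (hρ : (viewAutomaton π m).IsAcceptingRun W ρ) :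
    (∀ i, W.label i = π (View.label (ρ i).1)) ∧
    ∀ i (w : List Dir) (hw : w.length ≤ m + 1),
      (ρ i).1.1 ⟨w, hw⟩ = W.twoPage.obs (fun i => View.label (ρ i).1) i w := by
  obtain ⟨⟨⟨q, hq, h0⟩, hstep⟩, -, hcall⟩ := hρ
  obtain ⟨h0m, h0l, h0b, h0p, -⟩ := h0
  have hret : ∀ i c, W.mu c (i + 1) → W.label (i + 1) ∈ A.rets := by
    intro i c hc
    obtain ⟨s, hs⟩ := (W.mu_iff_exists_edge _ _).1 hc
    exact Set.mem_iUnion.2 ⟨s, W.edge_mem_retsOf hs⟩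
  have hδ₂ : ∀ i c, W.mu c (i + 1) →
      (ρ c, ρ i, W.label (i + 1), ρ (i + 1)) ∈ (viewAutomaton π m).δ₂ :=
    fun i c hc => (hstep i).1 c (hret i c hc) hc
  have hδ₁ : ∀ i, (∀ c, ¬W.mu c (i + 1)) →
      (ρ i, W.label (i + 1), ρ (i + 1)) ∈ (viewAutomaton π m).δ₁ :=
    fun i hc => (hstep i).2 fun h => h.2.elim hc
  have hmark : ∀ i, (ρ i).2 = false := by
    rintro (_ | i)
    · exact h0m
    · by_cases hc : ∃ c, W.mu c (i + 1)
      · obtain ⟨c, hc⟩ := hc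
        exact (hδ₂ i c hc).2.1
      · exact (hδ₁ i (not_exists.1 hc)).1
  have hlabel : ∀ i, W.label i = π (View.label (ρ i).1) := by
    rintro (_ | i)
    · exact h0l.symm
    · by_cases hc : ∃ c, W.mu c (i + 1)
      · obtain ⟨c, hc⟩ := hc
        exact (hδ₂ i c hc).2.2.1.symm
      · exact (hδ₁ i (not_exists.1 hc)).2.1.symm
  have hedge : ∀ o i j, W.twoPage.edge o i j → View.Compat (o, true) (ρ i).1 (ρ j).1 := by
    rintro (_ | s) i j h
    · obtain rfl : j = i + 1 := h
      by_cases hc : ∃ c, W.mu c (i + 1)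
      · obtain ⟨c, hc⟩ := hc
        exact (hδ₂ i c hc).2.2.2.1
      · exact (hδ₁ i (not_exists.1 hc)).2.2.2.2 (hmark i)
    · obtain ⟨j, rfl⟩ : ∃ k, j = k + 1 := ⟨j - 1, by have := TwoPage.edge_lt h; omega⟩
      obtain ⟨-, -, -, -, s', hs', hcomp, -⟩ := hδ₂ j i h.1
      obtain rfl := CallReturnAlphabet.retsOf_unique hs' (W.edge_mem_retsOf h)
      exact hcomp
  have hblocked : ∀ d i, (∀ j, ¬W.twoPage.Step d i j) → View.Blocked d (ρ i).1 := by
    rintro ⟨_ | s, _ | _⟩ i h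
    · rcases i with _ | i
      · exact h0p hq
      · exact absurd rfl (h i)
    · exact absurd rfl (h (i + 1))
    · rcases i with _ | i
      · exact h0b s
      · by_cases hc : ∃ c, W.mu c (i + 1)
        · obtain ⟨c, hc⟩ := hc
          obtain ⟨-, -, -, -, s', hs', -, hb⟩ := hδ₂ i c hc
          refine hb s ?_
          rintro rfl
          obtain ⟨s'', hs''⟩ := (W.mu_iff_exists_edge _ _).1 hc
          obtain rfl := CallReturnAlphabet.retsOf_unique hs' (W.edge_mem_retsOf hs'')
          exact h c hs''
        · exact (hδ₁ i (not_exists.1 hc)).2.2.1 s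
    · by_contra hb
      obtain ⟨-, j, hj⟩ := hcall i ⟨s, hb⟩
      have := View.mem_callsOf_of_not_blocked hb
      rw [← hlabel] at this
      exact h j ⟨hj, this⟩
  refine ⟨hlabel, fun i w => ?_⟩
  induction w generalizing i with
  | nil =>
    intro hw
    rw [TwoPage.obs_nil]
    exact View.val_nil _
  | cons d w ih =>
    intro hw
    have hw' : w.length ≤ m := Nat.le_of_succ_le_succ hw
    by_cases hex : ∃ j, W.twoPage.Step d i j
    · obtain ⟨j, hj⟩ := hex
      rw [hj.obs_cons, ← ih j (by omega)]
      rcases d with ⟨o, _ | _⟩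
      · exact (hedge o j i hj w hw').2
      · exact (hedge o i j hj w hw').1
    · rw [TwoPage.obs_cons_eq_none (not_exists.1 hex)]
      exact (hblocked d i (not_exists.1 hex)).val_cons hw

end Automaton

theorem mainTheorem8 (A : CallReturnAlphabet.{u} 2) (r : ℕ) :
    ∃ (B : GenNWA A) (η : B.Q → Spheres A r),
      B.omegaLanguage = Set.univ ∧
      ∀ (W : InfNestedWord A) (ρ : ℕ → B.Q), B.IsAcceptingRun W ρ →
        ∀ i : ℕ, (η (ρ i)).1.Isomorphic (W.sphere r i) := by
  have := A.finite_letter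
  obtain ⟨N, ⟨e⟩⟩ := Finite.exists_equiv_fin A.Letter
  obtain ⟨M, hM⟩ := TwoPage.exists_separates (2 * r + 1)
  let π : Fin N × Fin (M + 1) → A.Letter := fun c => e.symm c.1
  have hview : ∀ q : View π (2 * r + 1), ∃ V l x, IsViewOf π (2 * r + 1) q.1 V l x := fun q => q.2
  choose V l x hview using hview
  refine ⟨viewAutomaton π (2 * r + 1),
    fun q => ⟨(V q.1).sphere r (x q.1), (V q.1).sphere_mem_spheres r (x q.1)⟩, ?_, ?_⟩
  · refine Set.eq_univ_of_forall fun W => ?_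
    obtain ⟨χ, hχ⟩ := hM W.twoPage
    refine mem_omegaLanguage (l := fun i => (e (W.label i), χ i)) (fun i => by simp [π]) ?_
    exact fun w i j hw hp h => hχ w i j hw hp (congrArg Prod.snd h)
  · intro W ρ hρ i
    obtain ⟨hlabel, hobs⟩ := obs_of_isAcceptingRun hρ
    have hreal : ∀ i (w : List Dir), w.length ≤ 2 * r + 1 + 1 →
        W.twoPage.obs (fun i => View.label (ρ i).1) i w =
          (V (ρ i).1).twoPage.obs (l (ρ i).1) (x (ρ i).1) w :=
      fun i w hw => (hobs i w hw).symm.trans ((hview (ρ i).1).2.2 ⟨w, hw⟩)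
    refine InfNestedWord.sphere_isomorphic_of_obs π hlabel (hview (ρ i).1).1
      (TwoPage.separates_of_obs fun i => ⟨_, _, _, (hview (ρ i).1).2.1, hreal i⟩)
      (hview (ρ i).1).2.1 fun w hw => hreal i w (by omega)
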